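/- Let $\Sigma$ be a finite alphabet and $\mathbb{T}\Sigma^*$ the set of timed words $(t_1\cdot a_1)\cdots(t_n\cdot a_n)$ with $t_i\in\mathbb{R}_{\ge 0}$, $a_i\in\Sigma$. For $L\subseteq \mathbb{T}\Sigma^*$ write $u^{-1}L=\{w\mid uw\in L\}$. **Automata.** A 1-DTA is a deterministic one-clock timed automaton: finitely many states, finitely many transitions $(q,q',a,\phi,r)$ whose guard $\phi$ is a conjunction of constraints $c<x$, $x=c$, $x<c$ with $c\in\mathbb{N}$ and where $r\in\{0,1\}$ ($r=0$: the clock is reset, $r=1$: it is kept), distinct transitions with the same source and letter having disjoint guards. Its maximum constant is the largest constant in its guards ($0$ if it has no transition). It is complete if every timed word has exactly one run from the initial configuration (initial state, clock value $0$); its reset function then maps $u$ to the clock value at the end of the run on $u$. $L$ is 1-DTA recognizable if it is the language of some 1-DTA; then $K_L$ denotes the least maximum constant of a 1-DTA with language $L$. **Acceptors.** Write $y\equiv z$ if $\lfloor y\rfloor=\lfloor z\rfloor$ and ($y\in\mathbb{N}\Leftrightarrow z\in\mathbb{N}$). A $K$-region is a class of the equivalence $y\equiv^K z\iff (y\equiv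 z)\lor(y>K\land z>K)$ on $\mathbb{R}_{\ge0}$. A $K$-acceptor is a complete 1-DTA with maximum constant $K$, all of whose guards define $K$-regions, together with a $K$-region $\mathit{region}(q)$ for each state $q$, such that each run from the initial configuration that ends in $q$ ends with a clock value in $\mathit{region}(q)$. It is strict if every transition whose guard defines a set $\{n\}$, $n\in\mathbb{N}$, resets the clock. **Canonical acceptor.** Define $\mathbf{R}^L:\mathbb{T}\Sigma^*\to\mathbb{R}_{\ge0}$ by $\mathbf{R}^L(\epsilon)=0$, and $\mathbf{R}^L(u(t\cdot a))=0$ if $(u(t\cdot a))^{-1}L$ is 1-DTA recognizable, $\mathbf{R}^L(u(t\cdot a))=\mathbf{R}^L(u)+t$ otherwise. Let $\mathcal{HI}$ be the set of timed words all of whose delays are in $\frac12\mathbb{N}$, and for $u,v\in\mathcal{HI}$ let $u\approx^L v$ iff $\mathbf{R}^L(u)=\mathbf{R}^L(v)$ and $u^{-1}L=v^{-1}L$. Let $K\in\mathbb{N}\cup\{\infty\}$ be the infimum of the $k\in\mathbb{N}$ such that, for all $u\in\mathcal{HI}$, $a\in\Sigma$, $n\in\mathbb{N}$, $\mathbf{R}^L(u)+\frac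 n2>k$ implies $u(\frac n2\cdot a)\approx^L u(k+\frac12\cdot a)$ (with $K=\infty$ if there is no such $k$). For $t\ge0$ let $\phi_K(t)$ be $x=t$ if $t\le K$ and $t\in\mathbb{N}$; $\lfloor t\rfloor<x<\lceil t\rceil$ if $t\le K$ and $t\notin\mathbb{N}$; and $K<x$ if $t>K$. The automaton $\mathcal{A}_{(\mathbf{R}^L,\approx^L)}$ has as states the classes $[u]$ of $\approx^L$ ($u\in\mathcal{HI}$), initial state $[\epsilon]$, final states $[u]$ with $u\in L\cap\mathcal{HI}$, and the transitions $([u],[v],a,\phi_K(\mathbf{R}^L(u)+\frac n2),s)$ for $u,v\in\mathcal{HI}$, $a\in\Sigma$, $n\in\mathbb{N}$ with $u(\frac n2\cdot a)\approx^L v$, where $s=0$ if $\mathbf{R}^L(v)=0$ and $s=1$ otherwise. **Proposition.** Let $L\subseteq\mathbb{T}\Sigma^*$ be 1-DTA recognizable. 1. $\mathcal{A}_{(\mathbf{R}^L,\approx^L)}$ is a strict $K_L$-acceptor (in particular it is finite) with language $L$ and reset function $\mathbf{R}^L$. Its regions can moreover be chosen so that for every state $q$: if some transition into $q$ resets the clock,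 then every transition into $q$ does and $\mathit{region}(q)=\{0\}$; otherwise the guard of every transition into $q$ defines $\mathit{region}(q)$. 2. Every strict acceptor (that is, strict $K$-acceptor for any $K\in\mathbb{N}$) with language $L$ has at least as many states as $\mathcal{A}_{(\mathbf{R}^L,\approx^L)}$. -/

import Mathlib

open scoped NNReal ENNReal

namespace OneClock

/-- Timed words `(t₁·a₁) ⋯ (tₙ·aₙ)`: finite sequences of pairs (delay, letter). -/
abbrev TimedWord (α : Type*) := List (ℝ≥0 × α)

/-- Timed languages. -/
abbrev TimedLanguage (α : Type*) := Set (TimedWord α)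

/-- The residual language `u⁻¹L`. -/
def residual {α : Type*} (u : TimedWord α) (L : TimedLanguage α) : TimedLanguage α :=
  {w | u ++ w ∈ L}

/-! ### One-clock timed automata -/

/-- Clock constraints `c < x`, `x = c`, `x < c`, `φ ∧ ψ`. -/
inductive Constraint where
  | gt (c : ℕ) : Constraint
  | eq (c : ℕ) : Constraint
  | lt (c : ℕ) : Constraint
  | and (φ ψ : Constraint) : Constraint

/-- The set `⟦φ⟧` of clock values satisfying a constraint. -/
def Constraint.sat : Constraint → Set ℝ≥0
  | .gt c => {x | (c : ℝ≥0) < x}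
  | .eq c => {x | x = (c : ℝ≥0)}
  | .lt c => {x | x < (c : ℝ≥0)}
  | .and φ ψ => φ.sat ∩ ψ.sat

/-- The largest constant occurring in a constraint. -/
def Constraint.maxConst : Constraint → ℕ
  | .gt c => c
  | .eq c => c
  | .lt c => c
  | .and φ ψ => max φ.maxConst ψ.maxConst

/-- Transitions `(q, q', a, φ, r)`; `reset = true` is the value `r = 0` (the clock is reset),
`reset = false` is the value `r = 1` (the clock is kept). -/
structure Transition (α Q : Type*) where
  src : Q
  tgt : Q
  letter : α
  guard : Constraint
  reset : Bool

/-- The data of a one-clock automaton. Finiteness of the sets of states and of transitions is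
part of `OneTA.IsDTA` below. -/
structure OneTA (α Q : Type*) where
  init : Q
  trans : Set (Transition α Q)
  accept : Set Q

namespace OneTA

variable {α Q : Type*}

/-- `A.Run c w e c'`: the sequence `e` of transitions is a run of `A` on `w` from the
configuration `c` to the configuration `c'`. -/
inductive Run (A : OneTA α Q) :
    Q × ℝ≥0 → TimedWord α → List (Transition α Q) → Q × ℝ≥0 → Prop
  | nil (c : Q × ℝ≥0) : Run A c [] [] c
  | cons (θ : Transition α Q) (ν t : ℝ≥0) (w : TimedWord α) (e : List (Transition α Q))
      (c' : Q × ℝ≥0) (hθ : θ ∈ A.trans) (hg : ν + t ∈ θ.guard.sat)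
      (hrun : Run A (θ.tgt, if θ.reset then 0 else ν + t) w e c') :
      Run A (θ.src, ν) ((t, θ.letter) :: w) (θ :: e) c'

/-- `c ⇝ʷ c'`. -/
def Reaches (A : OneTA α Q) (c : Q × ℝ≥0) (w : TimedWord α) (c' : Q × ℝ≥0) : Prop :=
  ∃ e, A.Run c w e c'

/-- The language `𝓛(A)`. -/
def language (A : OneTA α Q) : TimedLanguage α :=
  {w | ∃ q ν, q ∈ A.accept ∧ A.Reaches (A.init, 0) w (q, ν)}

/-- Distinct transitions with the same source and letter have disjoint guards. -/
def Deterministic (A : OneTA α Q) : Prop :=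
  ∀ θ ∈ A.trans, ∀ θ' ∈ A.trans, θ ≠ θ' →
    θ.src ≠ θ'.src ∨ θ.letter ≠ θ'.letter ∨ Disjoint θ.guard.sat θ'.guard.sat

/-- `A` is a `1`-DTA. -/
structure IsDTA (A : OneTA α Q) : Prop where
  finite_states : Finite Q
  finite_trans : A.trans.Finite
  deterministic : A.Deterministic

/-- Every timed word has exactly one run from the initial configuration. -/
def Complete (A : OneTA α Q) : Prop :=
  ∀ w : TimedWord α, ∃! e : List (Transition α Q), ∃ c, A.Run (A.init, 0) w e c

/-- `K` is the largest constant in the transitions of `A` (`0` if there is no transition). -/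
def HasMaxConst (A : OneTA α Q) (K : ℕ) : Prop :=
  IsLUB {c | ∃ θ ∈ A.trans, c = θ.guard.maxConst} K

/-- For complete deterministic `A`: the reset function `R^A` induced by `A` is `R`, that is,
the run of `A` on each word `u` ends with clock value `R u`. -/
def HasResetFunction (A : OneTA α Q) (R : TimedWord α → ℝ≥0) : Prop :=
  ∀ u, ∃ q, A.Reaches (A.init, 0) u (q, R u)

end OneTA

/-- `L` is `1`-DTA recognizable. -/
def Recognizable {α : Type*} (L : TimedLanguage α) : Prop :=
  ∃ (Q : Type) (A : OneTA α Q), A.IsDTA ∧ A.language = L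

/-- `K_L`: the smallest `K` such that some `1`-DTA with maximum constant `K` accepts `L`
(meant for recognizable `L`, where such a `K` exists). -/
noncomputable def languageConst {α : Type*} (L : TimedLanguage α) : ℕ :=
  sInf {K | ∃ (Q : Type) (A : OneTA α Q), A.IsDTA ∧ A.HasMaxConst K ∧ A.language = L}

/-! ### Regions and acceptors -/

/-- `y ≡ z`: same integral part, and the fractional parts are both zero or both nonzero. -/
def RegionEq (y z : ℝ≥0) : Prop :=
  ⌊y⌋₊ = ⌊z⌋₊ ∧ ((⌊y⌋₊ : ℝ≥0) = y ↔ (⌊z⌋₊ : ℝ≥0) = z)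

/-- `y ≡ᴷ z`. -/
def RegionEqUpTo (K : ℕ) (y z : ℝ≥0) : Prop :=
  RegionEq y z ∨ ((K : ℝ≥0) < y ∧ (K : ℝ≥0) < z)

/-- `S` is a `K`-region, i.e. a class of `≡ᴷ`. -/
def IsRegion (K : ℕ) (S : Set ℝ≥0) : Prop :=
  ∃ y, S = {z | RegionEqUpTo K y z}

namespace OneTA

variable {α Q : Type*}

/-- `region` assigns to every state a `K`-region that contains the clock value of every run
ending in that state. -/
def IsRegionAssignment (A : OneTA α Q) (K : ℕ) (region : Q → Set ℝ≥0) : Prop :=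
  (∀ q, IsRegion K (region q)) ∧
    ∀ u q ν, A.Reaches (A.init, 0) u (q, ν) → ν ∈ region q

/-- The syntactic form of the condition on regions: if some transition into `q` resets, then all
transitions into `q` reset and the region of `q` is `{0}`; otherwise the guard of every transition
into `q` defines the region of `q`. -/
def IsSyntacticRegionAssignment (A : OneTA α Q) (region : Q → Set ℝ≥0) : Prop :=
  ∀ q,
    ((∃ θ ∈ A.trans, θ.tgt = q ∧ θ.reset = true) →
      (∀ θ ∈ A.trans, θ.tgt = q → θ.reset = true) ∧ region q = {0}) ∧
    ((¬ ∃ θ ∈ A.trans, θ.tgt = q ∧ θ.reset = true) →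
      ∀ θ ∈ A.trans, θ.tgt = q → θ.guard.sat = region q)

/-- `K`-acceptors: complete `1`-DTAs with maximum constant `K`, all of whose guards define
`K`-regions, with a `K`-region attached to every state. -/
structure IsAcceptor (A : OneTA α Q) (K : ℕ) : Prop where
  isDTA : A.IsDTA
  complete : A.Complete
  maxConst : A.HasMaxConst K
  guard_region : ∀ θ ∈ A.trans, IsRegion K θ.guard.sat
  region : ∃ region : Q → Set ℝ≥0, A.IsRegionAssignment K region

/-- Strict `K`-acceptors: every transition with an equality guard `x = n` resets the clock. -/
structure IsStrictAcceptor (A : OneTA α Q) (K : ℕ) : Prop where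
  isAcceptor : A.IsAcceptor K
  strict : ∀ θ ∈ A.trans, ∀ n : ℕ, θ.guard.sat = {(n : ℝ≥0)} → θ.reset = true

end OneTA

/-! ### Reset functions -/

/-- Reset functions `R`: `R(ε) = 0`, and `R(u(t·a))` is `0` or `R(u) + t`. -/
structure ResetFunction (α : Type*) where
  toFun : TimedWord α → ℝ≥0
  map_nil : toFun [] = 0
  map_concat : ∀ u t a, toFun (u ++ [(t, a)]) = 0 ∨ toFun (u ++ [(t, a)]) = toFun u + t

open Classical in
/-- The values of the syntactic reset function `R^L`, by recursion on the last letter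
(see `synResetVal_nil` and `synResetVal_concat`). -/
noncomputable def synResetVal {α : Type*} (L : TimedLanguage α) (u : TimedWord α) : ℝ≥0 :=
  List.reverseRecOn u 0 fun v p r => if Recognizable (residual (v ++ [p]) L) then 0 else r + p.1

theorem synResetVal_nil {α : Type*} (L : TimedLanguage α) : synResetVal L [] = 0 := by
  simp [synResetVal]

open Classical in
theorem synResetVal_concat {α : Type*} (L : TimedLanguage α) (u : TimedWord α) (t : ℝ≥0) (a : α) :
    synResetVal L (u ++ [(t, a)]) =
      if Recognizable (residual (u ++ [(t, a)]) L) then 0 else synResetVal L u + t := by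
  simp [synResetVal]

/-- The syntactic reset function `R^L`. -/
noncomputable def synReset {α : Type*} (L : TimedLanguage α) : ResetFunction α where
  toFun := synResetVal L
  map_nil := synResetVal_nil L
  map_concat u t a := by
    rw [synResetVal_concat]
    split_ifs
    · exact Or.inl rfl
    · exact Or.inr rfl

/-! ### Half-integral words and profiles -/

/-- The set of half-integral words: all delays are of the form `m / 2`. -/
def HI (α : Type*) : Type _ :=
  {w : TimedWord α // ∀ p ∈ w, ∃ m : ℕ, p.1 = (m : ℝ≥0) / 2}

namespace HI

variable {α : Type*}

/-- The empty word. -/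
def nil : HI α := ⟨[], by simp⟩

/-- The half-integral word `u (n/2 · a)`. -/
noncomputable def concat (u : HI α) (n : ℕ) (a : α) : HI α :=
  ⟨u.1 ++ [((n : ℝ≥0) / 2, a)], by
    intro p hp
    rcases List.mem_append.1 hp with h | h
    · exact u.2 p h
    · rw [List.mem_singleton] at h
      exact ⟨n, by rw [h]⟩⟩

end HI

/-- Profiles `(R, ≈)`. -/
structure Profile (α : Type*) where
  R : ResetFunction α
  rel : Setoid (HI α)

namespace Profile

variable {α : Type*}

/-- The proposition `C(K)`; note that `K + 1/2 = (2K + 1)/2`. -/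
def C (P : Profile α) (K : ℕ) : Prop :=
  ∀ (u : HI α) (a : α) (n : ℕ), (K : ℝ≥0) < P.R.toFun u.1 + (n : ℝ≥0) / 2 →
    P.rel.r (u.concat n a) (u.concat (2 * K + 1) a)

/-- `K_(R,≈) = inf {K | C(K)}` in `ℕ ∪ {∞}`, with value `∞` if there is no such `K`. -/
noncomputable def const (P : Profile α) : ℕ∞ :=
  sInf {k | ∃ K : ℕ, P.C K ∧ k = (K : ℕ∞)}

end Profile

open Classical in
/-- The clock constraint `φ_K(t)`. The last case occurs only for finite `K`. -/
noncomputable def phi (K : ℕ∞) (t : ℝ≥0) : Constraint :=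
  if (t : ℝ≥0∞) ≤ (K : ℝ≥0∞) then
    if (⌊t⌋₊ : ℝ≥0) = t then .eq ⌊t⌋₊ else .and (.gt ⌊t⌋₊) (.lt ⌈t⌉₊)
  else .gt K.toNat

open Classical in
/-- The automaton `A_(R,≈)` (for the language `L`), whose states are the classes of `≈`. -/
noncomputable def Profile.automaton {α : Type*} (P : Profile α) (L : TimedLanguage α) :
    OneTA α (Quotient P.rel) where
  init := Quotient.mk P.rel HI.nil
  trans := {θ | ∃ (u v : HI α) (a : α) (n : ℕ), P.rel.r (u.concat n a) v ∧
    θ = { src := Quotient.mk P.rel u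
          tgt := Quotient.mk P.rel v
          letter := a
          guard := phi P.const (P.R.toFun u.1 + (n : ℝ≥0) / 2)
          reset := decide (P.R.toFun v.1 = 0) }}
  accept := {q | ∃ u : HI α, u.1 ∈ L ∧ q = Quotient.mk P.rel u}

/-- The equivalence `≈^L`. -/
def synRel {α : Type*} (L : TimedLanguage α) : Setoid (HI α) where
  r u v := (synReset L).toFun u.1 = (synReset L).toFun v.1 ∧ residual u.1 L = residual v.1 L
  iseqv :=
    { refl := fun _ => ⟨rfl, rfl⟩
      symm := fun h => ⟨h.1.symm, h.2.symm⟩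
      trans := fun h h' => ⟨h.1.trans h'.1, h.2.trans h'.2⟩ }

/-- The syntactic profile `(R^L, ≈^L)`. -/
noncomputable def synProfile {α : Type*} (L : TimedLanguage α) : Profile α where
  R := synReset L
  rel := synRel L

/-- The states of the canonical acceptor: the classes of `≈^L`. -/
abbrev CanonicalState {α : Type*} (L : TimedLanguage α) : Type _ :=
  Quotient (synProfile L).rel

/-- The canonical acceptor `A_(R^L,≈^L)`. -/
noncomputable def canonicalAcceptor {α : Type*} (L : TimedLanguage α) :
    OneTA α (CanonicalState L) :=
  (synProfile L).automaton L

end OneClock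

namespace OneClock

universe u v w

/-! ### Regions -/

/-! View an automaton for `L` as a step function of the letter and the clock region (`RegionAut`). A
configuration whose clock value is an integer, or exceeds the maximum constant, accepts a
recognizable language (`RegionAut.recognizable_natCast`, `RegionAut.recognizable_of_lt`). So an
automaton cannot reset at a word whose residual is not recognizable. Hence the values of R^L are at
most the clock values, and at most the maximum constant, of any automaton for `L`; and a nonzero
value of R^L is never an integer, which is strictness.

The key is `RegionAut.lang_eq_of_recognizable`: a recognizable language accepted from (q, y) does
not change when y moves inside its region. A rescaling of time that commutes with integer
translations is invisible to an automaton started at clock value 0, yet it can move y to any value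
of its region. Therefore every timed word is shadowed by a half-integral one (`Shadows.concat`), and
the canonical acceptor, built from half-integral words only, runs on every word with clock value
R^L. The maximum constant of any automaton for `L` satisfies `C` (`RegionAut.profile_C`), which
yields K_L.

For minimality, every region contains exactly one half-integer, and in a strict acceptor an integral
clock value is 0 or larger than K. This forces the clock to equal R^L wherever R^L is nonzero on
half-integral words (`OneTA.IsStrictAcceptor.clock_eq`), so the state determines the class. -/

theorem regionEqUpTo_iff {K : ℕ} {x y : ℝ≥0} :
    RegionEqUpTo K x y ↔
      ∀ c : ℕ, c ≤ K → ((c : ℝ≥0) < x ↔ (c : ℝ≥0) < y) ∧ (x < c ↔ y < c) := by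
  constructor
  · rintro (⟨h, h'⟩ | ⟨h, h'⟩) c hc
    -- Comparison with integers sees only the floor and whether the value is integral.
    · have key : ∀ z : ℝ≥0, (c : ℝ≥0) < z ↔ c < ⌊z⌋₊ ∨ (c = ⌊z⌋₊ ∧ ¬ (⌊z⌋₊ : ℝ≥0) = z) := by
        intro z
        have hz : (⌊z⌋₊ : ℝ≥0) ≤ z := Nat.floor_le zero_le
        constructor
        · intro hcz
          rcases (Nat.le_floor hcz.le).lt_or_eq with h1 | h1
          · exact Or.inl h1
          · exact Or.inr ⟨h1, fun h2 => by rw [h1, h2] at hcz; exact lt_irrefl _ hcz⟩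
        · rintro (h1 | ⟨h1, h2⟩)
          · exact lt_of_lt_of_le (Nat.cast_lt.2 h1) hz
          · rw [h1]
            exact lt_of_le_of_ne hz h2
      rw [key x, key y, ← Nat.floor_lt zero_le, ← Nat.floor_lt zero_le, h']
      simp only [h, and_self]
    · have hcK : (c : ℝ≥0) ≤ K := Nat.cast_le.2 hc
      exact ⟨⟨fun _ => hcK.trans_lt h', fun _ => hcK.trans_lt h⟩,
        ⟨fun hx => absurd hx (hcK.trans h.le).not_gt,
          fun hx => absurd hx (hcK.trans h'.le).not_gt⟩⟩
  · intro H
    by_cases hx : (K : ℝ≥0) < x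
    · exact Or.inr ⟨hx, (H K le_rfl).1.1 hx⟩
    left
    have hy : ¬ (K : ℝ≥0) < y := fun hy => hx ((H K le_rfl).1.2 hy)
    have hxf : ⌊x⌋₊ ≤ K := by simpa using Nat.floor_mono (not_lt.1 hx)
    have hyf : ⌊y⌋₊ ≤ K := by simpa using Nat.floor_mono (not_lt.1 hy)
    have hle : (⌊x⌋₊ : ℝ≥0) ≤ x := Nat.floor_le zero_le
    have hle' : (⌊y⌋₊ : ℝ≥0) ≤ y := Nat.floor_le zero_le
    have h1 : ⌊x⌋₊ ≤ ⌊y⌋₊ := Nat.le_floor (not_lt.1 fun h => hle.not_gt ((H _ hxf).2.2 h))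
    have h2 : ⌊y⌋₊ ≤ ⌊x⌋₊ := Nat.le_floor (not_lt.1 fun h => hle'.not_gt ((H _ hyf).2.1 h))
    have he := le_antisymm h1 h2
    refine ⟨he, ?_⟩
    have h3 := (H _ hxf).1
    constructor
    · intro h
      rw [← he]
      exact le_antisymm (he ▸ hle') (not_lt.1 fun h' => (h3.2 h').ne h)
    · intro h
      exact le_antisymm hle (not_lt.1 fun h' => (h3.1 h').ne (he ▸ h))

theorem regionEq_iff {x y : ℝ≥0} :
    RegionEq x y ↔ ∀ c : ℕ, ((c : ℝ≥0) < x ↔ (c : ℝ≥0) < y) ∧ (x < c ↔ y < c) := by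
  constructor
  · intro h c
    exact regionEqUpTo_iff.1 (Or.inl h : RegionEqUpTo c x y) c le_rfl
  · intro h
    obtain ⟨K, hK⟩ := exists_nat_gt x
    rcases regionEqUpTo_iff.2 (fun c (_ : c ≤ K) => h c) with h' | h'
    · exact h'
    · exact absurd h'.1 hK.not_gt

theorem RegionEq.upTo {x y : ℝ≥0} (h : RegionEq x y) (K : ℕ) : RegionEqUpTo K x y := Or.inl h

theorem RegionEq.refl (x : ℝ≥0) : RegionEq x x := ⟨rfl, Iff.rfl⟩

theorem RegionEq.symm {x y : ℝ≥0} (h : RegionEq x y) : RegionEq y x := ⟨h.1.symm, h.2.symm⟩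

theorem RegionEq.eq_of_natCast {x y : ℝ≥0} (h : RegionEq x y) {n : ℕ} (hx : x = n) : y = x := by
  have := (regionEq_iff.1 h) n
  subst hx
  simp only [lt_irrefl, false_iff, not_lt] at this
  exact le_antisymm this.1 this.2

theorem RegionEqUpTo.refl (K : ℕ) (x : ℝ≥0) : RegionEqUpTo K x x := Or.inl (.refl x)

theorem RegionEqUpTo.symm {K : ℕ} {x y : ℝ≥0} (h : RegionEqUpTo K x y) : RegionEqUpTo K y x :=
  h.imp RegionEq.symm And.symm

theorem RegionEqUpTo.trans {K : ℕ} {x y z : ℝ≥0} (h : RegionEqUpTo K x y)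
    (h' : RegionEqUpTo K y z) : RegionEqUpTo K x z := by
  rw [regionEqUpTo_iff] at *
  exact fun c hc => ⟨(h c hc).1.trans (h' c hc).1, (h c hc).2.trans (h' c hc).2⟩

theorem RegionEqUpTo.lt_iff {K : ℕ} {x y : ℝ≥0} (h : RegionEqUpTo K x y) :
    (K : ℝ≥0) < x ↔ (K : ℝ≥0) < y :=
  (regionEqUpTo_iff.1 h K le_rfl).1

/-- Comparing with c becomes comparing with c - n, a smaller constant, or is trivial when c < n.
This keeps the constant K in `RegionAut.shift`. -/
theorem RegionEqUpTo.add_nat {K : ℕ} {x y : ℝ≥0} (h : RegionEqUpTo K x y) (n : ℕ) :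
    RegionEqUpTo K (x + n) (y + n) := by
  rw [regionEqUpTo_iff] at *
  intro c hc
  rcases le_or_gt n c with hn | hn
  · obtain ⟨d, rfl⟩ := Nat.exists_eq_add_of_le' hn
    simpa only [Nat.cast_add, add_lt_add_iff_right] using h d (by omega)
  · have hn' : (c : ℝ≥0) < n := Nat.cast_lt.2 hn
    have key : ∀ z : ℝ≥0, (c : ℝ≥0) < z + n := fun z => hn'.trans_le le_add_self
    exact ⟨iff_of_true (key x) (key y), iff_of_false (key x).le.not_gt (key y).le.not_gt⟩

theorem region_zero (K : ℕ) : {z : ℝ≥0 | RegionEqUpTo K 0 z} = {0} := by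
  ext z
  constructor
  · intro h
    have := (regionEqUpTo_iff.1 h 0 (Nat.zero_le _)).1
    simpa using this
  · rintro rfl
    exact .refl K _

theorem region_natCast {K n : ℕ} (hn : n ≤ K) {z : ℝ≥0} (h : RegionEqUpTo K n z) : z = n := by
  have := regionEqUpTo_iff.1 h n hn
  simp only [lt_irrefl, false_iff, not_lt] at this
  exact le_antisymm this.1 this.2

theorem IsRegion.regionEqUpTo {K : ℕ} {S : Set ℝ≥0} (hS : IsRegion K S) {x y : ℝ≥0}
    (hx : x ∈ S) (hy : y ∈ S) : RegionEqUpTo K x y := by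
  obtain ⟨z, rfl⟩ := hS
  exact RegionEqUpTo.trans (RegionEqUpTo.symm hx) hy

theorem IsRegion.eq_of_mem {K : ℕ} {S : Set ℝ≥0} (hS : IsRegion K S) {x : ℝ≥0}
    (hx : x ∈ S) : S = {z | RegionEqUpTo K x z} := by
  ext z
  refine ⟨fun hz => hS.regionEqUpTo hx hz, fun hz => ?_⟩
  obtain ⟨y, rfl⟩ := hS
  exact RegionEqUpTo.trans hx hz

theorem Constraint.sat_congr {K : ℕ} {x y : ℝ≥0} (h : RegionEqUpTo K x y) (φ : Constraint)
    (hφ : φ.maxConst ≤ K) : x ∈ φ.sat ↔ y ∈ φ.sat := by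
  induction φ with
  | gt c => exact (regionEqUpTo_iff.1 h c hφ).1
  | eq c =>
    have := regionEqUpTo_iff.1 h c hφ
    simp only [Constraint.sat, Set.mem_ofPred_eq, le_antisymm_iff, ← not_lt, this.1, this.2]
  | lt c => exact (regionEqUpTo_iff.1 h c hφ).2
  | and φ ψ ih1 ih2 =>
    simp only [Constraint.maxConst, max_le_iff] at hφ
    exact and_congr (ih1 hφ.1) (ih2 hφ.2)

theorem coe_le_natCast_iff {K : ℕ} {x : ℝ≥0} :
    (x : ℝ≥0∞) ≤ (((K : ℕ∞) : ℕ∞) : ℝ≥0∞) ↔ x ≤ K := by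
  rw [ENat.toENNReal_coe, ← ENNReal.coe_natCast, ENNReal.coe_le_coe]

theorem phi_natCast (K : ℕ) (x : ℝ≥0) :
    phi K x = if x ≤ K then
      if (⌊x⌋₊ : ℝ≥0) = x then .eq ⌊x⌋₊ else .and (.gt ⌊x⌋₊) (.lt ⌈x⌉₊)
    else .gt K := by
  simp only [phi, coe_le_natCast_iff, ENat.toNat_natCast]

theorem phi_of_lt {K : ℕ} {x : ℝ≥0} (h : (K : ℝ≥0) < x) : phi K x = .gt K := by
  rw [phi_natCast, if_neg h.not_ge]

theorem maxConst_phi_le (K : ℕ) (x : ℝ≥0) : (phi K x).maxConst ≤ K := by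
  rw [phi_natCast]
  split_ifs with h1 h2
  · simpa [Constraint.maxConst] using Nat.floor_mono h1
  · simp only [Constraint.maxConst, max_le_iff]
    exact ⟨by simpa using Nat.floor_mono h1, Nat.ceil_le.2 h1⟩
  · exact le_rfl

theorem mem_phi_self (K : ℕ) (x : ℝ≥0) : x ∈ (phi K x).sat := by
  rw [phi_natCast]
  split_ifs with h1 h2
  · exact h2.symm
  · have h3 : (⌊x⌋₊ : ℝ≥0) < x := lt_of_le_of_ne (Nat.floor_le zero_le) h2
    refine ⟨h3, lt_of_le_of_ne (Nat.le_ceil x) fun h => h2 ?_⟩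
    conv_lhs => rw [h, Nat.floor_natCast]
    exact h.symm
  · exact not_le.1 h1

theorem sat_phi (K : ℕ) (x : ℝ≥0) : (phi K x).sat = {z | RegionEqUpTo K x z} := by
  ext z
  refine ⟨fun hz => ?_, fun hz =>
    (Constraint.sat_congr hz _ (maxConst_phi_le K x)).1 (mem_phi_self K x)⟩
  rw [phi_natCast] at hz
  split_ifs at hz with h1 h2
  · rw [show z = x from hz.trans h2]
    exact .refl K x
  · have hx : (⌊x⌋₊ : ℝ≥0) < x := lt_of_le_of_ne (Nat.floor_le zero_le) h2
    have hz1 : (⌊x⌋₊ : ℝ≥0) < z := hz.1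
    have hz2 : z < ⌈x⌉₊ := hz.2
    have hc : ⌈x⌉₊ ≤ ⌊x⌋₊ + 1 := Nat.ceil_le_floor_add_one x
    have hzf : ⌊z⌋₊ = ⌊x⌋₊ := by
      refine (Nat.floor_eq_iff zero_le).2 ⟨hz1.le, hz2.trans_le ?_⟩
      exact_mod_cast hc
    refine Or.inl ⟨hzf.symm, ?_⟩
    rw [hzf]
    exact iff_of_false hx.ne hz1.ne
  · exact Or.inr ⟨not_le.1 h1, hz⟩

/-- The equality is one of syntax, not only of solution sets: determinism compares transitions, and
the guard is one of their components. -/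
theorem phi_congr {K : ℕ} {x y : ℝ≥0} (h : RegionEqUpTo K x y) : phi K x = phi K y := by
  have hK := h.lt_iff
  rw [phi_natCast, phi_natCast]
  by_cases hx : x ≤ K
  · have hy : y ≤ K := not_lt.1 fun hy => hx.not_gt (hK.2 hy)
    rw [if_pos hx, if_pos hy]
    rcases h with h | h
    · have hceil : ⌈x⌉₊ = ⌈y⌉₊ := by
        refine eq_of_forall_ge_iff fun c => ?_
        rw [Nat.ceil_le, Nat.ceil_le, ← not_lt, ← not_lt, (regionEq_iff.1 h c).1]
      simp only [h.2, hceil]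
      rw [h.1]
    · exact absurd h.1 hx.not_gt
  · rw [if_neg hx, if_neg fun hy => hx (not_lt.1 fun hx' => hy.not_gt (hK.1 hx'))]

theorem finite_range_phi (K : ℕ) : (Set.range fun x : ℝ≥0 => phi K x).Finite := by
  have h1 := ((Set.finite_Iic K).image Constraint.eq)
  have h2 := ((Set.finite_Iic K).prod (Set.finite_Iic K)).image
    fun p : ℕ × ℕ => Constraint.and (.gt p.1) (.lt p.2)
  refine ((h1.union h2).union (Set.finite_singleton (Constraint.gt K))).subset ?_
  rintro _ ⟨x, rfl⟩
  have hm := maxConst_phi_le K x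
  simp only [phi_natCast] at hm ⊢
  split_ifs at hm ⊢ with h1 h2
  · exact Or.inl (Or.inl ⟨_, hm, rfl⟩)
  · simp only [Constraint.maxConst, max_le_iff] at hm
    exact Or.inl (Or.inr ⟨(⌊x⌋₊, ⌈x⌉₊), ⟨hm.1, hm.2⟩, rfl⟩)
  · exact Or.inr rfl

/-! ### Half-integers -/

/-- The numbers `n / 2`. -/
def HalfIntegral (x : ℝ≥0) : Prop := ∃ n : ℕ, x = (n : ℝ≥0) / 2

theorem HalfIntegral.zero : HalfIntegral 0 := ⟨0, by simp⟩

theorem HalfIntegral.add {x y : ℝ≥0} (hx : HalfIntegral x) (hy : HalfIntegral y) :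
    HalfIntegral (x + y) := by
  obtain ⟨m, rfl⟩ := hx
  obtain ⟨n, rfl⟩ := hy
  exact ⟨m + n, by push_cast; ring⟩

theorem halfIntegral_even_or_odd {x : ℝ≥0} (hx : HalfIntegral x) :
    (∃ n : ℕ, x = n) ∨ ∃ n : ℕ, x = n + 1 / 2 := by
  obtain ⟨m, rfl⟩ := hx
  rcases Nat.even_or_odd' m with ⟨k, rfl | rfl⟩
  · exact Or.inl ⟨k, by push_cast; field_simp⟩
  · exact Or.inr ⟨k, by push_cast; field_simp⟩

theorem floor_add_half (n : ℕ) : ⌊(n : ℝ≥0) + 1 / 2⌋₊ = n := by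
  refine (Nat.floor_eq_iff zero_le).2 ⟨le_self_add, ?_⟩
  gcongr
  rw [div_lt_iff₀ (by norm_num)]
  norm_num

theorem add_half_ne_natCast (n m : ℕ) : (n : ℝ≥0) + 1 / 2 ≠ m := by
  intro h
  have h1 := floor_add_half n
  rw [h, Nat.floor_natCast] at h1
  subst h1
  simp at h

/-- The only half-integers with floor n are n and n + 1/2, and they lie in different regions. So
half-integers serve as unique representatives. -/
theorem RegionEq.eq_of_halfIntegral {x y : ℝ≥0} (h : RegionEq x y) (hx : HalfIntegral x)
    (hy : HalfIntegral y) : x = y := by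
  rcases halfIntegral_even_or_odd hx with ⟨n, hn⟩ | ⟨n, rfl⟩
  · exact (h.eq_of_natCast hn).symm
  rcases halfIntegral_even_or_odd hy with ⟨m, hm⟩ | ⟨m, rfl⟩
  · exact h.symm.eq_of_natCast hm
  · have := h.1
    rw [floor_add_half, floor_add_half] at this
    rw [this]

theorem exists_halfIntegral_regionEq (z : ℝ≥0) : ∃ h, HalfIntegral h ∧ RegionEq h z := by
  by_cases hz : (⌊z⌋₊ : ℝ≥0) = z
  · refine ⟨z, ⟨2 * ⌊z⌋₊, ?_⟩, .refl z⟩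
    push_cast
    rw [hz]
    field_simp
  · refine ⟨⌊z⌋₊ + 1 / 2, ⟨2 * ⌊z⌋₊ + 1, by push_cast; field_simp⟩, ?_⟩
    refine ⟨floor_add_half _, iff_of_false ?_ hz⟩
    rw [floor_add_half]
    exact fun h => add_half_ne_natCast _ _ h.symm

/-- Regions are linearly ordered, so the half-integer representing the region of x + t is at least
h, and the difference is the required half-integral delay. -/
theorem exists_regionEq_add {h x : ℝ≥0} (hh : HalfIntegral h) (hx : RegionEq x h) (t : ℝ≥0) :
    ∃ n : ℕ, RegionEq (x + t) (h + (n : ℝ≥0) / 2) := by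
  obtain ⟨r, hr, hrz⟩ := exists_halfIntegral_regionEq (x + t)
  have hle : h ≤ r := by
    by_contra hlt
    rw [not_le] at hlt
    have hxt : x ≤ x + t := le_self_add
    have key : ∀ c : ℕ, (x + t < c → x < c) ∧ (x + t ≤ c → x ≤ c) :=
      fun c => ⟨hxt.trans_lt, hxt.trans⟩
    rcases halfIntegral_even_or_odd hr with ⟨n, rfl⟩ | ⟨n, rfl⟩
    · have h1 : x + t ≤ n := not_lt.1 fun h' =>
        lt_irrefl _ (((regionEq_iff.1 hrz) n).1.2 h')
      exact ((regionEq_iff.1 hx n).1.2 hlt).not_ge (hxt.trans h1)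
    · have h1 : (n : ℝ≥0) + 1 / 2 < (n + 1 : ℕ) := by
        have := Nat.lt_floor_add_one ((n : ℝ≥0) + 1 / 2)
        rw [floor_add_half] at this
        exact_mod_cast this
      have h2 : h < (n + 1 : ℕ) :=
        (regionEq_iff.1 hx _).2.1 (hxt.trans_lt (((regionEq_iff.1 hrz) _).2.1 h1))
      rcases halfIntegral_even_or_odd hh with ⟨m, rfl⟩ | ⟨m, rfl⟩
      · have h3 : m < n + 1 := Nat.cast_lt.1 h2
        have h4 : (m : ℝ≥0) ≤ n := Nat.cast_le.2 (Nat.le_of_lt_succ h3)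
        exact hlt.not_ge (h4.trans le_self_add)
      · have h3 : m < n + 1 := Nat.cast_lt.1 (lt_of_le_of_lt le_self_add h2)
        have h4 : (m : ℝ≥0) ≤ n := Nat.cast_le.2 (Nat.le_of_lt_succ h3)
        exact hlt.not_ge (add_le_add_left h4 _)
  obtain ⟨m, rfl⟩ := hh
  obtain ⟨k, rfl⟩ := hr
  have hmk : m ≤ k := by
    have : (m : ℝ≥0) ≤ k := by
      rwa [div_le_div_iff_of_pos_right (by norm_num)] at hle
    exact_mod_cast this
  obtain ⟨n, rfl⟩ := Nat.exists_eq_add_of_le hmk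
  refine ⟨n, ?_⟩
  rw [← add_div, ← Nat.cast_add]
  exact hrz.symm

/-! ### Region automata -/

/-- Complete deterministic one-clock automata (without initial state), presented by a transition
function on pairs (letter, clock value) that depends only on the `K`-region of the clock value;
the Boolean tells whether the clock is reset. -/
structure RegionAut (α : Type u) (Q : Type v) (K : ℕ) where
  step : Q → α → ℝ≥0 → Q × Bool
  accept : Set Q
  step_congr : ∀ q a x y, RegionEqUpTo K x y → step q a x = step q a y

namespace RegionAut

variable {α : Type u} {Q : Type v} {K : ℕ}

/-- The configuration after reading one timed letter. -/
noncomputable def next (A : RegionAut α Q K) (c : Q × ℝ≥0) (p : ℝ≥0 × α) : Q × ℝ≥0 :=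
  ((A.step c.1 p.2 (c.2 + p.1)).1,
    if (A.step c.1 p.2 (c.2 + p.1)).2 then 0 else c.2 + p.1)

/-- The configuration after reading a timed word. -/
noncomputable def conf (A : RegionAut α Q K) (c : Q × ℝ≥0) (w : TimedWord α) : Q × ℝ≥0 :=
  w.foldl A.next c

/-- The language accepted from a configuration. -/
def lang (A : RegionAut α Q K) (c : Q × ℝ≥0) : TimedLanguage α :=
  {w | (A.conf c w).1 ∈ A.accept}

@[simp] theorem conf_cons (A : RegionAut α Q K) (c : Q × ℝ≥0) (p : ℝ≥0 × α) (w : TimedWord α) :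
    A.conf c (p :: w) = A.conf (A.next c p) w := rfl

theorem conf_append (A : RegionAut α Q K) (c : Q × ℝ≥0) (u w : TimedWord α) :
    A.conf c (u ++ w) = A.conf (A.conf c u) w := List.foldl_append

theorem conf_concat (A : RegionAut α Q K) (c : Q × ℝ≥0) (u : TimedWord α) (p : ℝ≥0 × α) :
    A.conf c (u ++ [p]) = A.next (A.conf c u) p := by
  rw [conf_append]; rfl

theorem residual_lang (A : RegionAut α Q K) (c : Q × ℝ≥0) (u : TimedWord α) :
    residual u (A.lang c) = A.lang (A.conf c u) := by
  ext w
  simp only [residual, lang, Set.mem_ofPred_eq, conf_append]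

theorem next_eq_or (A : RegionAut α Q K) (c : Q × ℝ≥0) (p : ℝ≥0 × α) :
    (A.next c p).2 = 0 ∨ (A.next c p).2 = c.2 + p.1 := by
  unfold next
  dsimp only
  split_ifs
  · exact Or.inl rfl
  · exact Or.inr rfl

/-- Up to the first reset both clocks stay above K, where the steps agree; after it the
configurations coincide. -/
theorem conf_fst_eq_of_lt (A : RegionAut α Q K) (w : TimedWord α) (q : Q) {x y : ℝ≥0}
    (hx : (K : ℝ≥0) < x) (hy : (K : ℝ≥0) < y) : (A.conf (q, x) w).1 = (A.conf (q, y) w).1 := by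
  induction w generalizing q x y with
  | nil => rfl
  | cons p w ih =>
    have hx' : (K : ℝ≥0) < x + p.1 := hx.trans_le le_self_add
    have hy' : (K : ℝ≥0) < y + p.1 := hy.trans_le le_self_add
    simp only [conf_cons, next]
    rw [A.step_congr q p.2 _ _ (Or.inr ⟨hx', hy'⟩)]
    split_ifs
    · rfl
    · exact ih _ hx' hy'

theorem lang_eq_of_lt (A : RegionAut α Q K) (q : Q) {x y : ℝ≥0}
    (hx : (K : ℝ≥0) < x) (hy : (K : ℝ≥0) < y) : A.lang (q, x) = A.lang (q, y) := by
  ext w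
  simp only [lang, Set.mem_ofPred_eq, A.conf_fst_eq_of_lt w q hx hy]

/-- Renaming of states. -/
def map {Q' : Type w} (A : RegionAut α Q K) (e : Q ≃ Q') : RegionAut α Q' K where
  step q a x := (e (A.step (e.symm q) a x).1, (A.step (e.symm q) a x).2)
  accept := {q | e.symm q ∈ A.accept}
  step_congr q a x y h := by rw [A.step_congr _ _ _ _ h]

theorem map_lang {Q' : Type w} (A : RegionAut α Q K) (e : Q ≃ Q') (q : Q) (x : ℝ≥0) :
    (A.map e).lang (e q, x) = A.lang (q, x) := by
  have key : ∀ (w : TimedWord α) (q : Q) (x : ℝ≥0),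
      ((A.map e).conf (e q, x) w).1 = e (A.conf (q, x) w).1 := by
    intro w
    induction w with
    | nil => intro q x; rfl
    | cons p w ih =>
      intro q x
      simp only [conf_cons, next, map, Equiv.symm_apply_apply]
      exact ih _ _
  ext w
  simp only [lang, Set.mem_ofPred_eq, key]
  simp [map]

/-- The automaton that starts with the clock advanced by `n`: the flag of a state tells whether
the clock has not been reset yet. -/
def shift (A : RegionAut α Q K) (n : ℕ) : RegionAut α (Q × Bool) K where
  step q a x :=
    (((A.step q.1 a (if q.2 then x + n else x)).1,
      q.2 && !(A.step q.1 a (if q.2 then x + n else x)).2),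
      (A.step q.1 a (if q.2 then x + n else x)).2)
  accept := {q | q.1 ∈ A.accept}
  step_congr q a x y h := by
    have : A.step q.1 a (if q.2 then x + n else x) = A.step q.1 a (if q.2 then y + n else y) := by
      split_ifs
      · exact A.step_congr _ _ _ _ (h.add_nat n)
      · exact A.step_congr _ _ _ _ h
    rw [this]

theorem shift_lang (A : RegionAut α Q K) (n : ℕ) (q : Q) :
    (A.shift n).lang ((q, true), 0) = A.lang (q, n) := by
  have key : ∀ (w : TimedWord α) (q : Q) (b : Bool) (x : ℝ≥0),
      ((A.shift n).conf ((q, b), x) w).1.1 = (A.conf (q, if b then x + n else x) w).1 := by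
    intro w
    induction w with
    | nil => intro q b x; rfl
    | cons p w ih =>
      intro q b x
      have hx : (if b then x + p.1 + n else x + p.1) = (if b then x + n else x) + p.1 := by
        split_ifs
        · ring
        · rfl
      simp only [conf_cons, next, shift, hx]
      refine (ih _ _ _).trans ?_
      congr 2
      ext1
      · rfl
      cases b <;> cases (A.step q p.2 _).2 <;> simp [add_right_comm]
  ext w
  have := key w q true 0
  simp only [if_true, zero_add] at this
  simp only [lang, Set.mem_ofPred_eq, ← this]
  rfl

/-! ### From region automata to timed automata -/

/-- The timed automaton with the transitions of a region automaton. -/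
noncomputable def toTA (A : RegionAut α Q K) (q₀ : Q) : OneTA α Q where
  init := q₀
  trans := {θ | ∃ q a x, θ = ⟨q, (A.step q a x).1, a, phi K x, (A.step q a x).2⟩}
  accept := A.accept

theorem toTA_run (A : RegionAut α Q K) (q₀ : Q) {c c' : Q × ℝ≥0} {w : TimedWord α}
    {e : List (Transition α Q)} (h : (A.toTA q₀).Run c w e c') : c' = A.conf c w := by
  induction h with
  | nil c => rfl
  | cons θ ν t w e c' hθ hg hrun ih =>
    obtain ⟨q, a, x, rfl⟩ := hθ
    rw [sat_phi] at hg
    rw [ih, conf_cons]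
    simp only [next]
    rw [A.step_congr q a x _ hg]

theorem toTA_reaches (A : RegionAut α Q K) (q₀ : Q) (c : Q × ℝ≥0) (w : TimedWord α) :
    (A.toTA q₀).Reaches c w (A.conf c w) := by
  induction w generalizing c with
  | nil => exact ⟨[], .nil c⟩
  | cons p w ih =>
    obtain ⟨e, he⟩ := ih (A.next c p)
    exact ⟨_, OneTA.Run.cons ⟨c.1, (A.step c.1 p.2 (c.2 + p.1)).1, p.2, phi K (c.2 + p.1),
      (A.step c.1 p.2 (c.2 + p.1)).2⟩ c.2 p.1 w e _ ⟨_, _, _, rfl⟩ (mem_phi_self _ _) he⟩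

theorem toTA_language (A : RegionAut α Q K) (q₀ : Q) :
    (A.toTA q₀).language = A.lang (q₀, 0) := by
  ext w
  constructor
  · rintro ⟨q, ν, hq, e, he⟩
    have := A.toTA_run q₀ he
    change (A.conf (q₀, 0) w).1 ∈ A.accept
    exact this ▸ hq
  · intro hw
    exact ⟨_, _, hw, A.toTA_reaches q₀ _ w⟩

end RegionAut

theorem finite_transitions {α : Type u} {Q : Type v} [Finite α] [Finite Q] (K : ℕ)
    (S : Set (Transition α Q)) (hS : ∀ θ ∈ S, ∃ x, θ.guard = phi K x) : S.Finite := by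
  have h1 : ((Set.univ : Set (Q × Q × α × Bool)) ×ˢ
      (Set.range fun x : ℝ≥0 => phi K x)).Finite :=
    Set.finite_univ.prod (finite_range_phi K)
  refine (h1.image fun p => (⟨p.1.1, p.1.2.1, p.1.2.2.1, p.2, p.1.2.2.2⟩ :
    Transition α Q)).subset ?_
  rintro ⟨q, q', a, g, r⟩ hθ
  obtain ⟨x, hx⟩ := hS _ hθ
  exact ⟨((q, q', a, r), g), ⟨Set.mem_univ _, x, hx.symm⟩, rfl⟩

/-- The guard K < x attains the bound. Over the empty alphabet there are no transitions, so the
maximum constant can only be 0. -/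
theorem hasMaxConst_of_phi {α : Type u} {Q : Type v} (A : OneTA α Q) (K : ℕ)
    (h1 : ∀ θ ∈ A.trans, ∃ x, θ.guard = phi K x) (h2 : IsEmpty α → K = 0)
    (h3 : α → ∃ θ ∈ A.trans, θ.guard = .gt K) : A.HasMaxConst K := by
  constructor
  · rintro _ ⟨θ, hθ, rfl⟩
    obtain ⟨x, hx⟩ := h1 θ hθ
    rw [hx]
    exact maxConst_phi_le K x
  · intro b hb
    rcases isEmpty_or_nonempty α with h | ⟨⟨a⟩⟩
    · rw [h2 h]
      exact Nat.zero_le b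
    · obtain ⟨θ, hθ, h⟩ := h3 a
      exact hb ⟨θ, hθ, by rw [h]; rfl⟩

namespace RegionAut

variable {α : Type u} {Q : Type v} {K : ℕ}

theorem toTA_isDTA [Finite α] [Finite Q] (A : RegionAut α Q K) (q₀ : Q) :
    (A.toTA q₀).IsDTA where
  finite_states := inferInstance
  finite_trans := finite_transitions K _ (by rintro _ ⟨q, a, x, rfl⟩; exact ⟨x, rfl⟩)
  deterministic := by
    rintro _ ⟨q, a, x, rfl⟩ _ ⟨q', a', x', rfl⟩ hne
    by_contra! hcon
    obtain ⟨rfl, rfl, hd⟩ := hcon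
    rw [Set.not_disjoint_iff] at hd
    obtain ⟨z, hz, hz'⟩ := hd
    simp only [sat_phi] at hz hz'
    have h : RegionEqUpTo K x x' := RegionEqUpTo.trans hz (RegionEqUpTo.symm hz')
    exact hne (by rw [A.step_congr _ _ _ _ h, phi_congr h])

theorem toTA_hasMaxConst (A : RegionAut α Q K) (q₀ : Q) (hK : IsEmpty α → K = 0) :
    (A.toTA q₀).HasMaxConst K :=
  hasMaxConst_of_phi _ _ (by rintro _ ⟨q, a, x, rfl⟩; exact ⟨x, rfl⟩) hK
    fun a => ⟨_, ⟨q₀, a, (K : ℝ≥0) + 1, rfl⟩, phi_of_lt (lt_add_of_pos_right _ one_pos)⟩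

/-- A region automaton can be turned into a timed automaton on states in `Type`. -/
theorem exists_dta [Finite α] [Finite Q] (A : RegionAut α Q K) (q₀ : Q) :
    ∃ (Q' : Type) (B : OneTA α Q'), B.IsDTA ∧ ((IsEmpty α → K = 0) → B.HasMaxConst K) ∧
      B.language = A.lang (q₀, 0) := by
  obtain ⟨n, ⟨e⟩⟩ := Finite.exists_equiv_fin Q
  refine ⟨Fin n, (A.map e).toTA (e q₀), toTA_isDTA _ _, toTA_hasMaxConst _ _, ?_⟩
  rw [toTA_language, map_lang]

theorem recognizable [Finite α] [Finite Q] (A : RegionAut α Q K) (q₀ : Q) :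
    Recognizable (A.lang (q₀, 0)) := by
  obtain ⟨Q', B, h1, -, h2⟩ := A.exists_dta q₀
  exact ⟨Q', B, h1, h2⟩

/-- An integral head start of the clock can be stored in the finite control until the first reset.
-/
theorem recognizable_natCast [Finite α] [Finite Q] (A : RegionAut α Q K) (q : Q) (n : ℕ) :
    Recognizable (A.lang (q, n)) := by
  rw [← shift_lang]
  exact recognizable _ _

theorem recognizable_of_lt [Finite α] [Finite Q] (A : RegionAut α Q K) (q : Q) {x : ℝ≥0}
    (hx : (K : ℝ≥0) < x) : Recognizable (A.lang (q, x)) := by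
  rw [A.lang_eq_of_lt q hx (y := (K + 1 : ℕ)) (by exact_mod_cast Nat.lt_succ_self K)]
  exact recognizable_natCast _ _ _

end RegionAut

/-! ### From timed automata to region automata -/

namespace OneTA

variable {α : Type u} {Q : Type v} {K : ℕ}

/-- The transition `θ` can be taken in state `q` with letter `a` and clock value `x`. -/
def Fires (B : OneTA α Q) (q : Q) (a : α) (x : ℝ≥0) (θ : Transition α Q) : Prop :=
  θ ∈ B.trans ∧ θ.src = q ∧ θ.letter = a ∧ x ∈ θ.guard.sat

theorem Deterministic.fires_unique {B : OneTA α Q} (hB : B.Deterministic) {q : Q} {a : α}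
    {x : ℝ≥0} {θ θ' : Transition α Q} (h : B.Fires q a x θ) (h' : B.Fires q a x θ') :
    θ = θ' := by
  by_contra hne
  rcases hB θ h.1 θ' h'.1 hne with h1 | h1 | h1
  · exact h1 (h.2.1.trans h'.2.1.symm)
  · exact h1 (h.2.2.1.trans h'.2.2.1.symm)
  · exact Set.disjoint_left.1 h1 h.2.2.2 h'.2.2.2

theorem Deterministic.run_unique {B : OneTA α Q} (hB : B.Deterministic) {c c₁ c₂ : Q × ℝ≥0}
    {w : TimedWord α} {e₁ e₂ : List (Transition α Q)} (h₁ : B.Run c w e₁ c₁)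
    (h₂ : B.Run c w e₂ c₂) : e₁ = e₂ ∧ c₁ = c₂ := by
  induction h₁ generalizing e₂ with
  | nil c => cases h₂; exact ⟨rfl, rfl⟩
  | cons θ ν t w e c' hθ hg hrun ih =>
    generalize hs : θ.src = s at h₂
    generalize ha : θ.letter = a at h₂
    cases h₂ with
    | cons θ' _ _ _ e' _ hθ' hg' hrun' =>
      obtain rfl : θ = θ' := hB.fires_unique ⟨hθ, hs, ha, hg⟩ ⟨hθ', rfl, rfl, hg'⟩
      obtain ⟨rfl, rfl⟩ := ih hrun'
      exact ⟨rfl, rfl⟩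

open Classical in
/-- Target and reset flag of a transition satisfying `P`, if there is one. -/
noncomputable def pick (P : Transition α Q → Prop) : Option Q × Bool :=
  if h : ∃ θ, P θ then (some h.choose.tgt, h.choose.reset) else (none, true)

theorem Deterministic.pick_eq {B : OneTA α Q} (hB : B.Deterministic) {q : Q} {a : α}
    {x : ℝ≥0} {θ : Transition α Q} (h : B.Fires q a x θ) :
    pick (B.Fires q a x) = (some θ.tgt, θ.reset) := by
  have hex : ∃ θ, B.Fires q a x θ := ⟨θ, h⟩
  rw [pick, dif_pos hex, hB.fires_unique hex.choose_spec h]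

/-- The region automaton of a timed automaton, completed with a sink state. -/
noncomputable def toRegionAut (B : OneTA α Q) (hK : ∀ θ ∈ B.trans, θ.guard.maxConst ≤ K) :
    RegionAut α (Option Q) K where
  step
    | none, _, _ => (none, true)
    | some q, a, x => pick (B.Fires q a x)
  accept := some '' B.accept
  step_congr q a x y h := by
    cases q with
    | none => rfl
    | some q =>
      refine congrArg pick (funext fun θ => propext ?_)
      refine and_congr_right fun hθ => and_congr_right fun _ => and_congr_right fun _ => ?_
      exact Constraint.sat_congr h _ (hK θ hθ)

theorem toRegionAut_conf {B : OneTA α Q} (hB : B.Deterministic)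
    (hK : ∀ θ ∈ B.trans, θ.guard.maxConst ≤ K) {c c' : Q × ℝ≥0} {w : TimedWord α}
    (h : B.Reaches c w c') :
    (B.toRegionAut hK).conf (some c.1, c.2) w = (some c'.1, c'.2) := by
  obtain ⟨e, h⟩ := h
  induction h with
  | nil c => rfl
  | cons θ ν t w e c' hθ hg hrun ih =>
    rw [RegionAut.conf_cons, ← ih]
    simp only [RegionAut.next, toRegionAut, hB.pick_eq ⟨hθ, rfl, rfl, hg⟩]

theorem toRegionAut_conf_none {B : OneTA α Q} (hK : ∀ θ ∈ B.trans, θ.guard.maxConst ≤ K)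
    (x : ℝ≥0) (w : TimedWord α) : ((B.toRegionAut hK).conf (none, x) w).1 = none := by
  induction w generalizing x with
  | nil => rfl
  -- The sink resets the clock at each letter.
  | cons p w ih => exact ih 0

theorem reaches_of_toRegionAut_conf {B : OneTA α Q}
    (hK : ∀ θ ∈ B.trans, θ.guard.maxConst ≤ K) {q q' : Q} {x : ℝ≥0} {w : TimedWord α}
    (h : ((B.toRegionAut hK).conf (some q, x) w).1 = some q') :
    ∃ ν, B.Reaches (q, x) w (q', ν) := by
  induction w generalizing q x with
  | nil =>
    obtain rfl : q = q' := Option.some_injective _ h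
    exact ⟨x, [], .nil _⟩
  | cons p w ih =>
    rw [RegionAut.conf_cons] at h
    by_cases hex : ∃ θ, B.Fires q p.2 (x + p.1) θ
    · have hp : pick (B.Fires q p.2 (x + p.1)) = (some hex.choose.tgt, hex.choose.reset) := by
        rw [pick, dif_pos hex]
      simp only [RegionAut.next, toRegionAut, hp] at h
      obtain ⟨ν, e, he⟩ := ih h
      obtain ⟨h1, h2, h3, h4⟩ := hex.choose_spec
      generalize hex.choose = θ at *
      subst h2
      obtain ⟨t, a⟩ := p
      dsimp only at *
      subst h3
      exact ⟨ν, _, .cons θ x t w e _ h1 h4 he⟩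
    · have hp : pick (B.Fires q p.2 (x + p.1)) = (none, true) := by
        rw [pick, dif_neg hex]
      simp only [RegionAut.next, toRegionAut, hp] at h
      exact absurd ((toRegionAut_conf_none hK _ w).symm.trans h) (by simp)

theorem toRegionAut_lang {B : OneTA α Q} (hB : B.Deterministic)
    (hK : ∀ θ ∈ B.trans, θ.guard.maxConst ≤ K) :
    (B.toRegionAut hK).lang (some B.init, 0) = B.language := by
  ext w
  constructor
  · rintro ⟨q, hq, h⟩
    obtain ⟨ν, hν⟩ := reaches_of_toRegionAut_conf hK h.symm
    exact ⟨q, ν, hq, hν⟩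
  · rintro ⟨q, ν, hq, h⟩
    exact ⟨q, hq, by rw [toRegionAut_conf hB hK h]⟩

theorem HasMaxConst.maxConst_le {B : OneTA α Q} (h : B.HasMaxConst K) :
    ∀ θ ∈ B.trans, θ.guard.maxConst ≤ K :=
  fun θ hθ => h.1 ⟨θ, hθ, rfl⟩

theorem IsDTA.exists_hasMaxConst {B : OneTA α Q} (hB : B.IsDTA) : ∃ K, B.HasMaxConst K := by
  have hS : {c | ∃ θ ∈ B.trans, c = θ.guard.maxConst}.Finite := by
    refine (hB.finite_trans.image fun θ => θ.guard.maxConst).subset ?_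
    rintro _ ⟨θ, hθ, rfl⟩
    exact ⟨θ, hθ, rfl⟩
  -- The least upper bound of the empty set in ℕ is 0, which matches the convention for automata
  -- without transitions.
  rcases Set.eq_empty_or_nonempty {c | ∃ θ ∈ B.trans, c = θ.guard.maxConst} with h | h
  · refine ⟨0, ?_⟩
    rw [HasMaxConst, h]
    exact isLUB_empty
  · exact ⟨_, isLUB_csSup h hS.bddAbove⟩

end OneTA

theorem Recognizable.exists_regionAut {α : Type u} {L : TimedLanguage α} (h : Recognizable L) :
    ∃ (Q : Type) (_ : Finite Q) (K : ℕ) (A : RegionAut α Q K) (q : Q), A.lang (q, 0) = L := by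
  obtain ⟨Q, B, hB, rfl⟩ := h
  obtain ⟨K, hK⟩ := hB.exists_hasMaxConst
  have := hB.finite_states
  exact ⟨Option Q, inferInstance, K, B.toRegionAut hK.maxConst_le, some B.init,
    OneTA.toRegionAut_lang hB.deterministic _⟩

/-! ### Rescaling of time -/

/-- Replace the delays of a word starting at time `T` according to the rescaling `f` of time. -/
noncomputable def rescale {α : Type u} (f : ℝ → ℝ) : ℝ → TimedWord α → TimedWord α
  | _, [] => []
  | T, p :: w => (Real.toNNReal (f (T + p.1) - f T), p.2) :: rescale f (T + p.1) w

/-- A clock with value x at time T was last reset at time T - x. Comparing x with c means comparing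
T with T - x + c, and `f` preserves the order and commutes with adding c. -/
theorem regionEq_of_rescale {f : ℝ → ℝ} (hf : StrictMono f)
    (hper : ∀ (s : ℝ) (n : ℕ), f (s + n) = f s + n) {x y : ℝ≥0} {T : ℝ}
    (h : (y : ℝ) = f T - f (T - x)) : RegionEq x y := by
  rw [regionEq_iff]
  intro c
  have h1 : (c : ℝ≥0) < x ↔ (c : ℝ) < x := by exact_mod_cast Iff.rfl
  have h2 : (c : ℝ≥0) < y ↔ (c : ℝ) < y := by exact_mod_cast Iff.rfl
  have h3 : x < (c : ℝ≥0) ↔ (x : ℝ) < c := by exact_mod_cast Iff.rfl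
  have h4 : y < (c : ℝ≥0) ↔ (y : ℝ) < c := by exact_mod_cast Iff.rfl
  rw [h1, h2, h3, h4, h]
  constructor
  · rw [show (c : ℝ) < x ↔ T - x + c < T by constructor <;> intro <;> linarith, ← hf.lt_iff_lt,
      hper]
    constructor <;> intro <;> linarith
  · rw [show (x : ℝ) < c ↔ T < T - x + c by constructor <;> intro <;> linarith, ← hf.lt_iff_lt,
      hper]
    constructor <;> intro <;> linarith

/-- The hypothesis on x, y and T is an invariant of the two runs: it survives the passage of time,
and after a reset both clocks are 0. Under it both runs take the same steps. -/
theorem RegionAut.mem_lang_rescale {α : Type u} {Q : Type v} {K : ℕ} (A : RegionAut α Q K)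
    {f : ℝ → ℝ} (hf : StrictMono f) (hper : ∀ (s : ℝ) (n : ℕ), f (s + n) = f s + n)
    (w : TimedWord α) (q : Q) {x y : ℝ≥0} {T : ℝ} (h : (y : ℝ) = f T - f (T - x)) :
    rescale f T w ∈ A.lang (q, y) ↔ w ∈ A.lang (q, x) := by
  induction w generalizing q x y T with
  | nil => rfl
  | cons p w ih =>
    have hnn : 0 ≤ f (T + p.1) - f T :=
      sub_nonneg.2 (hf.monotone (le_add_of_nonneg_right p.1.coe_nonneg))
    have h' : ((y + Real.toNNReal (f (T + p.1) - f T) : ℝ≥0) : ℝ) =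
        f (T + p.1) - f (T + p.1 - (x + p.1 : ℝ≥0)) := by
      push_cast
      rw [Real.coe_toNNReal _ hnn, h, show T + (p.1 : ℝ) - (x + p.1) = T - x by ring]
      ring
    change rescale f (T + p.1) w ∈ A.lang (A.next (q, y) _) ↔ w ∈ A.lang (A.next (q, x) p)
    simp only [RegionAut.next]
    rw [A.step_congr q p.2 _ _ ((regionEq_of_rescale hf hper h').upTo K)]
    split_ifs
    · exact ih _ (by simp)
    · exact ih _ h'

/-- Any number in `(0,1)` can be moved to any other by a rescaling of time. -/
theorem exists_rescaling {a b : ℝ} (ha : a ∈ Set.Ioo (0 : ℝ) 1) (hb : b ∈ Set.Ioo (0 : ℝ) 1) :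
    ∃ f : ℝ → ℝ, StrictMono f ∧ (∀ (s : ℝ) (n : ℕ), f (s + n) = f s + n) ∧ f 0 = 0 ∧
      f a = b := by
  have hp : 0 < Real.logb a b := Real.logb_pos_of_base_lt_one ha.1 ha.2 hb.1 hb.2
  -- The power is an increasing map of [0,1) to itself, and the exponent is chosen so that a goes to
  -- b.
  refine ⟨fun s => ⌊s⌋ + Int.fract s ^ Real.logb a b, ?_, ?_, ?_, ?_⟩
  · intro s s' hs
    dsimp only
    rcases (Int.floor_mono hs.le).lt_or_eq with h | h
    · have h1 : Int.fract s ^ Real.logb a b < 1 :=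
        Real.rpow_lt_one (Int.fract_nonneg s) (Int.fract_lt_one s) hp
      have h2 : 0 ≤ Int.fract s' ^ Real.logb a b := Real.rpow_nonneg (Int.fract_nonneg s') _
      have h3 : (⌊s⌋ : ℝ) + 1 ≤ ⌊s'⌋ := by exact_mod_cast h
      linarith
    · have h1 : Int.fract s < Int.fract s' := by
        rw [Int.fract, Int.fract, h]
        linarith
      have h2 := Real.rpow_lt_rpow (Int.fract_nonneg s) h1 hp
      rw [h]
      linarith
  · intro s n
    simp only [Int.floor_add_natCast, Int.fract_add_natCast]
    push_cast
    ring
  · simp [Real.zero_rpow hp.ne']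
  · have h1 : ⌊a⌋ = 0 := Int.floor_eq_zero_iff.2 ⟨ha.1.le, ha.2⟩
    simp only [h1, Int.fract_eq_self.2 ⟨ha.1.le, ha.2⟩, Int.cast_zero, zero_add]
    exact Real.rpow_logb ha.1 ha.2.ne hb.1

/-- If the language accepted from a configuration is recognizable, then it depends only on the
region of the clock value. -/
theorem RegionAut.lang_eq_of_recognizable {α : Type u} {Q : Type v} {K : ℕ}
    (A : RegionAut α Q K) (q : Q) {y z : ℝ≥0} (hyz : RegionEq y z)
    (hrec : Recognizable (A.lang (q, y))) :
    A.lang (q, z) = A.lang (q, y) := by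
  by_cases hy : (⌊y⌋₊ : ℝ≥0) = y
  · rw [hyz.eq_of_natCast hy.symm]
  obtain ⟨Q', _, K', A', q', hA'⟩ := hrec.exists_regionAut
  have hz : (⌊z⌋₊ : ℝ≥0) ≠ z := fun h => hy (hyz.2.2 h)
  have frac : ∀ x : ℝ≥0, (⌊x⌋₊ : ℝ≥0) ≠ x →
      (⌊x⌋₊ + 1 - x : ℝ) ∈ Set.Ioo (0 : ℝ) 1 := by
    intro x hx
    have h1 : (⌊x⌋₊ : ℝ≥0) < x := lt_of_le_of_ne (Nat.floor_le zero_le) hx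
    have h2 := Nat.lt_floor_add_one x
    have h1' : ((⌊x⌋₊ : ℕ) : ℝ) < x := by exact_mod_cast h1
    have h2' : (x : ℝ) < (⌊x⌋₊ : ℕ) + 1 := by exact_mod_cast h2
    constructor <;> linarith
  -- At time 0 a clock with value z was reset at -z. Translated by ⌊z⌋ + 1, this time lies in (0,1);
  -- sending it to the corresponding point for y makes `f` map -z to -y.
  obtain ⟨f, hf, hper, hf0, hfa⟩ := exists_rescaling (frac z hz) (frac y hy)
  have hfz : (y : ℝ) = f 0 - f (0 - z) := by
    have := hper (0 - z) (⌊z⌋₊ + 1)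
    rw [show (0 - z + ((⌊z⌋₊ + 1 : ℕ) : ℝ)) = (⌊z⌋₊ + 1 - z : ℝ) by push_cast; ring, hfa,
      hyz.1] at this
    push_cast at this
    linarith
  ext w
  -- `A` read from z turns w into its rescaled version read from y; the automaton `A'` for that same
  -- language starts with clock value 0, hence does not notice the rescaling.
  rw [← A.mem_lang_rescale hf hper w q hfz, ← hA',
    A'.mem_lang_rescale hf hper w q' (x := 0) (by simp)]

/-! ### The syntactic reset function of a recognizable language -/

theorem residual_append {α : Type u} (v w : TimedWord α) (L : TimedLanguage α) :
    residual (v ++ w) L = residual w (residual v L) := by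
  ext x
  simp only [residual, Set.mem_ofPred_eq, List.append_assoc]

theorem RegionAut.residual_concat {α : Type u} {Q : Type v} {K : ℕ} {L : TimedLanguage α}
    {A : RegionAut α Q K} {c : Q × ℝ≥0} {w : TimedWord α} (h : residual w L = A.lang c)
    (p : ℝ≥0 × α) : residual (w ++ [p]) L = A.lang (A.next c p) := by
  rw [residual_append, h, RegionAut.residual_lang]
  rfl

section

variable {α : Type u} {L : TimedLanguage α}

theorem synResetVal_of_recognizable {w : TimedWord α} (h : Recognizable (residual w L)) :
    synResetVal L w = 0 := by
  cases w using List.reverseRecOn with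
  | nil => exact synResetVal_nil L
  | append_singleton w p => rw [synResetVal_concat, if_pos h]

theorem synResetVal_of_not_recognizable {w : TimedWord α} {t : ℝ≥0} {a : α}
    (h : ¬ Recognizable (residual (w ++ [(t, a)]) L)) :
    synResetVal L (w ++ [(t, a)]) = synResetVal L w + t := by
  rw [synResetVal_concat, if_neg h]

theorem HI.synResetVal_halfIntegral (v : HI α) : HalfIntegral (synResetVal L v.1) := by
  obtain ⟨w, hw⟩ := v
  dsimp only
  induction w using List.reverseRecOn with
  | nil => rw [synResetVal_nil]; exact .zero
  | append_singleton w p ih =>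
    rw [synResetVal_concat]
    split_ifs
    · exact .zero
    · exact (ih fun q hq => hw q (by simp [hq])).add (hw p (by simp))

theorem RegionAut.conf_halfIntegral {Q : Type v} {K : ℕ} (A : RegionAut α Q K) (q : Q)
    (v : HI α) : HalfIntegral (A.conf (q, 0) v.1).2 := by
  obtain ⟨w, hw⟩ := v
  dsimp only
  induction w using List.reverseRecOn with
  | nil => exact .zero
  | append_singleton w p ih =>
    rw [A.conf_concat]
    rcases A.next_eq_or (A.conf (q, 0) w) p with h | h
    · rw [h]; exact .zero
    · rw [h]
      exact (ih fun q hq => hw q (by simp [hq])).add (hw p (by simp))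

theorem synRel_concat {x y : HI α} (h : (synRel L).r x y) (n : ℕ) (a : α) :
    (synRel L).r (x.concat n a) (y.concat n a) := by
  obtain ⟨h1, h2⟩ := h
  have h3 : residual (x.concat n a).1 L = residual (y.concat n a).1 L := by
    simp only [HI.concat, residual_append, h2]
  refine ⟨?_, h3⟩
  change synResetVal L x.1 = synResetVal L y.1 at h1
  change synResetVal L (x.concat n a).1 = synResetVal L (y.concat n a).1
  change residual (x.1 ++ _) L = residual (y.1 ++ _) L at h3
  simp only [HI.concat, synResetVal_concat, h1]
  rw [h3]

/-- Take a fresh automaton each time the residual becomes recognizable, and follow the current one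
otherwise. In the latter case it cannot reset, since a configuration with clock value 0 accepts a
recognizable language, so its clock advances as R^L does. -/
theorem exists_residual_eq_lang [Finite α] (hL : Recognizable L) (w : TimedWord α) :
    ∃ (Q : Type) (_ : Finite Q) (K : ℕ) (A : RegionAut α Q K) (q : Q),
      residual w L = A.lang (q, synResetVal L w) := by
  induction w using List.reverseRecOn with
  | nil =>
    obtain ⟨Q, hQ, K, A, q, h⟩ := hL.exists_regionAut
    exact ⟨Q, hQ, K, A, q, by rw [synResetVal_nil, h]; rfl⟩
  | append_singleton w p ih =>
    obtain ⟨t, a⟩ := p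
    by_cases hrec : Recognizable (residual (w ++ [(t, a)]) L)
    · obtain ⟨Q, hQ, K, A, q, h⟩ := hrec.exists_regionAut
      exact ⟨Q, hQ, K, A, q, by rw [synResetVal_of_recognizable hrec, h]⟩
    · obtain ⟨Q, hQ, K, A, q, h⟩ := ih
      have h1 := A.residual_concat h (t, a)
      refine ⟨Q, hQ, K, A, (A.next (q, synResetVal L w) (t, a)).1, ?_⟩
      rw [h1, synResetVal_of_not_recognizable hrec]
      congr 1
      ext1
      · rfl
      rcases A.next_eq_or (q, synResetVal L w) (t, a) with h2 | h2
      · refine absurd ?_ hrec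
        rw [h1, ← Prod.mk.eta (p := A.next _ _), h2]
        exact A.recognizable _
      · exact h2

theorem recognizable_of_synResetVal_eq_natCast [Finite α] (hL : Recognizable L) {w : TimedWord α} {n : ℕ}
    (h : synResetVal L w = n) : Recognizable (residual w L) := by
  obtain ⟨Q, _, K, A, q, hq⟩ := exists_residual_eq_lang hL w
  rw [hq, h]
  exact A.recognizable_natCast q n

theorem synResetVal_eq_zero_of_natCast [Finite α] (hL : Recognizable L) {w : TimedWord α} {n : ℕ}
    (h : synResetVal L w = n) : synResetVal L w = 0 :=
  synResetVal_of_recognizable (recognizable_of_synResetVal_eq_natCast hL h)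

theorem synResetVal_eq_zero_iff [Finite α] (hL : Recognizable L) {w : TimedWord α} :
    synResetVal L w = 0 ↔ Recognizable (residual w L) :=
  ⟨fun h => recognizable_of_synResetVal_eq_natCast hL (n := 0) (by simpa using h),
    synResetVal_of_recognizable⟩

/-! ### Comparison of R^L with an arbitrary automaton for `L` -/

section

variable [Finite α] {Q : Type v} [Finite Q] {K : ℕ}

/-- When the automaton resets, the residual is recognizable and R^L is 0 as well. -/
theorem RegionAut.synResetVal_le (A : RegionAut α Q K) {q : Q} (hA : A.lang (q, 0) = L)
    (w : TimedWord α) : synResetVal L w ≤ (A.conf (q, 0) w).2 := by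
  induction w using List.reverseRecOn with
  | nil => rw [synResetVal_nil]; exact zero_le
  | append_singleton w p ih =>
    obtain ⟨t, a⟩ := p
    by_cases hrec : Recognizable (residual (w ++ [(t, a)]) L)
    · rw [synResetVal_of_recognizable hrec]; exact zero_le
    · rw [synResetVal_of_not_recognizable hrec]
      have h1 : residual (w ++ [(t, a)]) L = A.lang (A.conf (q, 0) (w ++ [(t, a)])) := by
        rw [← hA, A.residual_lang]
      rw [A.conf_concat] at h1 ⊢
      rcases A.next_eq_or (A.conf (q, 0) w) (t, a) with h2 | h2
      · refine absurd ?_ hrec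
        rw [h1, ← Prod.mk.eta (p := A.next _ _), h2]
        exact A.recognizable _
      · rw [h2]
        exact add_le_add_left ih t

theorem RegionAut.synResetVal_le_const (A : RegionAut α Q K) {q : Q}
    (hA : A.lang (q, 0) = L) (w : TimedWord α) : synResetVal L w ≤ K := by
  by_contra! h
  have h1 := h.trans_le (A.synResetVal_le hA w)
  have h2 : residual w L = A.lang (A.conf (q, 0) w) := by rw [← hA, A.residual_lang]
  rw [← Prod.mk.eta (p := A.conf _ _)] at h2
  rw [synResetVal_of_recognizable (h2 ▸ A.recognizable_of_lt _ h1)] at h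
  exact not_lt_zero h

/-- If R^L plus the delay exceeds K, so does the larger clock value of `A`, which thus takes the
same step as after the delay K + 1/2. With or without a reset, the two residuals agree and are
recognizable, so R^L is 0 at both words. -/
theorem RegionAut.profile_C (A : RegionAut α Q K) {q : Q} (hA : A.lang (q, 0) = L) :
    (synProfile L).C K := by
  intro v a n hn
  change (K : ℝ≥0) < synResetVal L v.1 + (n : ℝ≥0) / 2 at hn
  have hle := A.synResetVal_le hA v.1
  set c := A.conf (q, 0) v.1 with hc
  have hres : residual v.1 L = A.lang c := by rw [← hA, A.residual_lang]
  have h1 : (K : ℝ≥0) < c.2 + (n : ℝ≥0) / 2 := hn.trans_le (add_le_add_left hle _)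
  have h2 : (K : ℝ≥0) < c.2 + ((2 * K + 1 : ℕ) : ℝ≥0) / 2 := by
    refine lt_of_lt_of_le ?_ le_add_self
    rw [lt_div_iff₀ (by norm_num)]
    push_cast
    rw [mul_comm]
    exact lt_add_of_pos_right _ one_pos
  have h3 := A.residual_concat hres ((n : ℝ≥0) / 2, a)
  have h4 := A.residual_concat hres (((2 * K + 1 : ℕ) : ℝ≥0) / 2, a)
  simp only [RegionAut.next] at h3 h4
  rw [A.step_congr c.1 a _ _ (Or.inr ⟨h1, h2⟩)] at h3
  have h5 : residual (v.concat n a).1 L = residual (v.concat (2 * K + 1) a).1 L ∧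
      Recognizable (residual (v.concat n a).1 L) := by
    change residual (v.1 ++ _) L = residual (v.1 ++ _) L ∧ Recognizable (residual (v.1 ++ _) L)
    rw [h3, h4]
    split_ifs
    · exact ⟨rfl, A.recognizable _⟩
    · exact ⟨A.lang_eq_of_lt _ h1 h2, A.recognizable_of_lt _ h1⟩
  exact ⟨(synResetVal_of_recognizable h5.2).trans
    (synResetVal_of_recognizable (h5.1 ▸ h5.2)).symm, h5.1⟩

end

/-- A class is a pair of a value of R^L, a half-integer at most K, and a residual, which is accepted
from a state with a half-integral clock value. -/
theorem finite_canonicalState [Finite α] (hL : Recognizable L) : Finite (CanonicalState L) := by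
  obtain ⟨Q, _, K, A, q, hA⟩ := hL.exists_regionAut
  have hfin : (((fun n : ℕ => (n : ℝ≥0) / 2) '' Set.Iic (2 * K)) ×ˢ
      (Set.range fun p : Q × Set.Iic (2 * K + 1) => A.lang (p.1, ((p.2 : ℕ) : ℝ≥0) / 2))).Finite :=
    ((Set.finite_Iic _).image _).prod (Set.finite_range _)
  have half_le : ∀ {n m : ℕ}, (n : ℝ≥0) / 2 ≤ (m : ℝ≥0) → n ≤ 2 * m := by
    intro n m h
    rw [div_le_iff₀ (by norm_num)] at h
    rw [mul_comm]
    exact_mod_cast h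
  have hmem : ∀ v : HI α, (synResetVal L v.1, residual v.1 L) ∈
      (((fun n : ℕ => (n : ℝ≥0) / 2) '' Set.Iic (2 * K)) ×ˢ
      (Set.range fun p : Q × Set.Iic (2 * K + 1) => A.lang (p.1, ((p.2 : ℕ) : ℝ≥0) / 2))) := by
    intro v
    constructor
    · obtain ⟨n, hn⟩ := v.synResetVal_halfIntegral (L := L)
      have := A.synResetVal_le_const hA v.1
      rw [hn] at this
      exact ⟨n, half_le this, hn.symm⟩
    · have h2 : residual v.1 L = A.lang (A.conf (q, 0) v.1) := by rw [← hA, A.residual_lang]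
      obtain ⟨n, hn⟩ := A.conf_halfIntegral q v
      rw [← Prod.mk.eta (p := A.conf _ _), hn] at h2
      dsimp only
      rw [h2]
      by_cases hle : n ≤ 2 * K + 1
      · exact ⟨(_, ⟨n, hle⟩), rfl⟩
      · have hlt : ∀ m : ℕ, 2 * K < m → (K : ℝ≥0) < (m : ℝ≥0) / 2 := by
          intro m hm
          rw [lt_div_iff₀ (by norm_num)]
          norm_cast
          omega
        -- All values above K accept the same language, so K + 1/2 stands for them.
        exact ⟨((A.conf (q, 0) v.1).1, ⟨2 * K + 1, Set.mem_Iic.2 le_rfl⟩),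
          A.lang_eq_of_lt _ (hlt _ (by simp)) (hlt _ (by omega))⟩
  have := hfin.to_subtype
  refine Finite.of_injective (β := ↥(((fun n : ℕ => (n : ℝ≥0) / 2) '' Set.Iic (2 * K)) ×ˢ
      (Set.range fun p : Q × Set.Iic (2 * K + 1) => A.lang (p.1, ((p.2 : ℕ) : ℝ≥0) / 2))))
    (fun s : CanonicalState L => ⟨_, hmem s.out⟩) ?_
  intro s s' h
  rw [Subtype.mk.injEq, Prod.mk.injEq] at h
  rw [← s.out_eq, ← s'.out_eq]
  exact Quotient.sound h

theorem exists_const_eq [Finite α] (hL : Recognizable L) :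
    ∃ K : ℕ, (synProfile L).const = K ∧ (synProfile L).C K ∧
      ∀ K', (synProfile L).C K' → K ≤ K' := by
  classical
  obtain ⟨Q, _, K, A, q, hA⟩ := hL.exists_regionAut
  have hex : ∃ K, (synProfile L).C K := ⟨K, A.profile_C hA⟩
  refine ⟨Nat.find hex, ?_, Nat.find_spec hex, fun K' h => Nat.find_min' hex h⟩
  apply le_antisymm
  · exact sInf_le ⟨_, Nat.find_spec hex, rfl⟩
  · refine le_sInf ?_
    rintro _ ⟨K', hK', rfl⟩
    exact Nat.cast_le.2 (Nat.find_min' hex hK')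

end

/-! ### The canonical acceptor -/

/-- The half-integral word `v` follows the same path as `w`: the residual languages are accepted
by region-equivalent configurations, with the values of the syntactic reset function as clock
values. -/
def Shadows {α : Type u} (L : TimedLanguage α) (w : TimedWord α) (v : HI α) : Prop :=
  RegionEq (synResetVal L w) (synResetVal L v.1) ∧
    ∃ (Q : Type) (_ : Finite Q) (K : ℕ) (A : RegionAut α Q K) (q : Q),
      residual w L = A.lang (q, synResetVal L w) ∧
        residual v.1 L = A.lang (q, synResetVal L v.1)

section

variable {α : Type u} {L : TimedLanguage α}

theorem shadows_nil [Finite α] (hL : Recognizable L) : Shadows L [] HI.nil := by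
  obtain ⟨Q, hQ, K, A, q, h⟩ := exists_residual_eq_lang hL []
  exact ⟨.refl _, Q, hQ, K, A, q, h, h⟩

theorem Shadows.mem_iff {w : TimedWord α} {v : HI α} (h : Shadows L w v) :
    w ∈ L ↔ v.1 ∈ L := by
  obtain ⟨-, Q, -, K, A, q, h1, h2⟩ := h
  have key : ∀ x : TimedWord α, x ∈ L ↔ [] ∈ residual x L := fun x => by
    simp only [residual, Set.mem_ofPred_eq, List.append_nil]
  rw [key w, key v.1, h1, h2]
  rfl

/-- Both values of R^L are 0, and one automaton for the common residual serves both words. -/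
theorem shadows_of_residual_eq {w : TimedWord α} {v : HI α}
    (h : residual w L = residual v.1 L) (hrec : Recognizable (residual w L)) :
    Shadows L w v := by
  have h1 := synResetVal_of_recognizable hrec
  have h2 := synResetVal_of_recognizable (h ▸ hrec)
  obtain ⟨Q, hQ, K, A, q, hA⟩ := hrec.exists_regionAut
  refine ⟨by rw [h1, h2]; exact .refl 0, Q, hQ, K, A, q, ?_, ?_⟩
  · rw [h1, hA]
  · rw [h2, hA, h]

/-- Both words take the same step of the common automaton. If it resets, the residuals coincide. If
not, but one residual is recognizable, they coincide by `RegionAut.lang_eq_of_recognizable`.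
Otherwise R^L advances on both sides and the automaton is kept. -/
theorem Shadows.concat [Finite α] {w : TimedWord α} {v : HI α} (h : Shadows L w v) {t : ℝ≥0} {n : ℕ}
    (ht : RegionEq (synResetVal L w + t) (synResetVal L v.1 + (n : ℝ≥0) / 2)) (a : α) :
    Shadows L (w ++ [(t, a)]) (v.concat n a) := by
  obtain ⟨-, Q, hQ, K, A, q, h1, h2⟩ := h
  have h3 := A.residual_concat h1 (t, a)
  have h4 : residual (v.concat n a).1 L = _ := A.residual_concat h2 ((n : ℝ≥0) / 2, a)
  simp only [RegionAut.next] at h3 h4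
  rw [← A.step_congr q a _ _ (ht.upTo K)] at h4
  generalize A.step q a (synResetVal L w + t) = s at h3 h4
  split_ifs at h3 h4 with hs
  · exact shadows_of_residual_eq (h3.trans h4.symm) (h3 ▸ A.recognizable _)
  by_cases hrec : Recognizable (residual (w ++ [(t, a)]) L)
  · refine shadows_of_residual_eq ?_ hrec
    rw [h3] at hrec
    rw [h3, h4, A.lang_eq_of_recognizable _ ht hrec]
  · have hrec' : ¬ Recognizable (residual (v.concat n a).1 L) := by
      intro h'
      rw [h4] at h'
      exact hrec (by rwa [h3, A.lang_eq_of_recognizable _ ht.symm h'])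
    have h5 := synResetVal_of_not_recognizable hrec
    have h6 : synResetVal L (v.concat n a).1 = _ := synResetVal_of_not_recognizable hrec'
    exact ⟨by rw [h5, h6]; exact ht, Q, hQ, K, A, s.1, by rw [h3, h5], by rw [h4, h6]⟩

/-- The representative of the target may be taken to be the extended word itself, since equivalent
words have the same value of R^L and so give the same reset flag. -/
theorem mem_canonicalAcceptor_trans {K : ℕ} (hK : (synProfile L).const = K)
    {θ : Transition α (CanonicalState L)} :
    θ ∈ (canonicalAcceptor L).trans ↔ ∃ (v : HI α) (n : ℕ) (a : α),
      θ = { src := Quotient.mk _ v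
            tgt := Quotient.mk _ (v.concat n a)
            letter := a
            guard := phi K (synResetVal L v.1 + (n : ℝ≥0) / 2)
            reset := decide (synResetVal L (v.concat n a).1 = 0) } := by
  rw [← hK]
  constructor
  · rintro ⟨v, v', a, n, hv, rfl⟩
    refine ⟨v, n, a, ?_⟩
    have h1 : (Quotient.mk (synProfile L).rel v') = Quotient.mk _ (v.concat n a) :=
      (Quotient.sound hv).symm
    have h2 : synResetVal L (v.concat n a).1 = synResetVal L v'.1 := hv.1
    rw [h1, h2]
    rfl
  · rintro ⟨v, n, a, rfl⟩
    exact ⟨v, v.concat n a, a, n, (synProfile L).rel.iseqv.refl _, rfl⟩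

end

section

variable {α : Type u} {L : TimedLanguage α} {K : ℕ}

theorem OneTA.Run.concat {Q : Type v} {A : OneTA α Q} {c : Q × ℝ≥0} {w : TimedWord α}
    {e : List (Transition α Q)} {θ : Transition α Q} {ν t : ℝ≥0}
    (h : A.Run c w e (θ.src, ν)) (hθ : θ ∈ A.trans) (hg : ν + t ∈ θ.guard.sat) :
    A.Run c (w ++ [(t, θ.letter)]) (e ++ [θ]) (θ.tgt, if θ.reset then 0 else ν + t) := by
  generalize hc : (θ.src, ν) = c' at h
  induction h with
  | nil c =>
    subst hc
    exact .cons θ ν t [] [] _ hθ hg (.nil _)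
  | cons θ' ν' t' w e c' hθ' hg' hrun ih => exact .cons θ' ν' t' _ _ _ hθ' hg' (ih hc)

theorem OneTA.Run.eq_of_nil {Q : Type v} {A : OneTA α Q} {c c' : Q × ℝ≥0}
    {e : List (Transition α Q)} (h : A.Run c [] e c') : c' = c := by
  generalize hw : ([] : TimedWord α) = w at h
  cases h with
  | nil => rfl
  | cons => simp at hw

/-- Overlapping guards are the same K-region. Either the two half-integral clock values agree, and
then so do the delays, as equivalent sources have the same R^L; or both exceed K, and `C` identifies
both targets with the one for delay K + 1/2. -/
theorem canonicalAcceptor_deterministic (hK : (synProfile L).const = K)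
    (hC : (synProfile L).C K) : (canonicalAcceptor L).Deterministic := by
  intro θ hθ θ' hθ' hne
  obtain ⟨v, n, a, rfl⟩ := (mem_canonicalAcceptor_trans hK).1 hθ
  obtain ⟨v', n', a', rfl⟩ := (mem_canonicalAcceptor_trans hK).1 hθ'
  by_contra! hcon
  obtain ⟨hs, ha, hd⟩ := hcon
  obtain rfl : a = a' := ha
  change Quotient.mk (synProfile L).rel v = Quotient.mk _ v' at hs
  rw [Set.not_disjoint_iff] at hd
  obtain ⟨z, hz, hz'⟩ := hd
  simp only [sat_phi] at hz hz'
  have h := RegionEqUpTo.trans hz (RegionEqUpTo.symm hz')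
  have hv : (synRel L).r v v' := Quotient.exact hs
  have hR : synResetVal L v.1 = synResetVal L v'.1 := hv.1
  have hvv : (synRel L).r (v.concat n a) (v'.concat n' a) := by
    rcases h with h | h
    · have h1 := h.eq_of_halfIntegral (v.synResetVal_halfIntegral.add ⟨n, rfl⟩)
        (v'.synResetVal_halfIntegral.add ⟨n', rfl⟩)
      rw [hR] at h1
      have h2 := add_left_cancel h1
      rw [div_left_inj' (by norm_num), Nat.cast_inj] at h2
      subst h2
      exact synRel_concat hv n a
    · exact (synRel L).iseqv.trans (hC v a n h.1)
        ((synRel L).iseqv.trans (synRel_concat hv _ a)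
          ((synRel L).iseqv.symm (hC v' a n' h.2)))
  have htgt : (Quotient.mk (synProfile L).rel (v.concat n a)) =
      Quotient.mk _ (v'.concat n' a) := Quotient.sound hvv
  have hRR : synResetVal L (v.concat n a).1 = synResetVal L (v'.concat n' a).1 := hvv.1
  apply hne
  rw [phi_congr h, htgt, hRR, hs]

theorem canonicalAcceptor_isDTA [Finite α] (hL : Recognizable L)
    (hK : (synProfile L).const = K) (hC : (synProfile L).C K) :
    (canonicalAcceptor L).IsDTA := by
  have := finite_canonicalState hL
  refine ⟨this, finite_transitions K _ fun θ hθ => ?_, canonicalAcceptor_deterministic hK hC⟩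
  obtain ⟨v, n, a, rfl⟩ := (mem_canonicalAcceptor_trans hK).1 hθ
  exact ⟨_, rfl⟩

/-- On every timed word, the canonical acceptor has a run which ends in the class of a
half-integral word shadowing it. -/
theorem canonicalAcceptor_reaches [Finite α] (hL : Recognizable L)
    (hK : (synProfile L).const = K) (w : TimedWord α) :
    ∃ v : HI α, Shadows L w v ∧ (canonicalAcceptor L).Reaches ((canonicalAcceptor L).init, 0) w
      (Quotient.mk _ v, synResetVal L w) := by
  induction w using List.reverseRecOn with
  | nil => exact ⟨HI.nil, shadows_nil hL, [], by rw [synResetVal_nil]; exact .nil _⟩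
  | append_singleton w p ih =>
    obtain ⟨t, a⟩ := p
    obtain ⟨v, hv, e, he⟩ := ih
    obtain ⟨n, hn⟩ := exists_regionEq_add v.synResetVal_halfIntegral hv.1 t
    have hvn := hv.concat hn a
    refine ⟨_, hvn, e ++ [⟨Quotient.mk _ v, Quotient.mk _ (v.concat n a), a,
      phi K (synResetVal L v.1 + (n : ℝ≥0) / 2),
      decide (synResetVal L (v.concat n a).1 = 0)⟩], ?_⟩
    convert OneTA.Run.concat he (θ := ⟨Quotient.mk _ v, Quotient.mk _ (v.concat n a), a,
      phi K (synResetVal L v.1 + (n : ℝ≥0) / 2), decide (synResetVal L (v.concat n a).1 = 0)⟩)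
      ((mem_canonicalAcceptor_trans hK).2 ⟨v, n, a, rfl⟩) (t := t) ?_ using 2
    -- The reset flag is read off the half-integral word, the clock off the timed word; they agree
    -- because {0} is a region.
    · by_cases h0 : synResetVal L (v.concat n a).1 = 0
      · simp only [h0, decide_true, if_true]
        rw [hvn.1.symm.eq_of_natCast (n := 0) (by simpa using h0), h0]
      · simp only [h0, decide_false, Bool.false_eq_true, if_false]
        refine synResetVal_of_not_recognizable fun hrec => h0 ?_
        have h1 := synResetVal_of_recognizable hrec
        rw [hvn.1.eq_of_natCast (n := 0) (by simpa using h1), h1]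
    · rw [sat_phi]
      exact RegionEq.upTo hn.symm K

theorem canonicalAcceptor_eq_of_reaches [Finite α] (hL : Recognizable L)
    (hK : (synProfile L).const = K) (hC : (synProfile L).C K) {w : TimedWord α}
    {q : CanonicalState L} {ν : ℝ≥0}
    (h : (canonicalAcceptor L).Reaches ((canonicalAcceptor L).init, 0) w (q, ν)) :
    ∃ v : HI α, Shadows L w v ∧ q = Quotient.mk _ v ∧ ν = synResetVal L w := by
  obtain ⟨v, hv, e, he⟩ := canonicalAcceptor_reaches hL hK w
  obtain ⟨e', he'⟩ := h
  have := ((canonicalAcceptor_deterministic hK hC).run_unique he' he).2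
  rw [Prod.mk.injEq] at this
  exact ⟨v, hv, this⟩

theorem canonicalAcceptor_complete [Finite α] (hL : Recognizable L)
    (hK : (synProfile L).const = K) (hC : (synProfile L).C K) :
    (canonicalAcceptor L).Complete := by
  intro w
  obtain ⟨v, -, e, he⟩ := canonicalAcceptor_reaches hL hK w
  refine ⟨e, ⟨_, he⟩, ?_⟩
  rintro e' ⟨c, he'⟩
  exact ((canonicalAcceptor_deterministic hK hC).run_unique he' he).1

theorem mem_canonicalAcceptor_accept {v : HI α} :
    (Quotient.mk _ v) ∈ (canonicalAcceptor L).accept ↔ v.1 ∈ L := by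
  constructor
  · rintro ⟨v', hv', h⟩
    have h1 : residual v.1 L = residual v'.1 L := (Quotient.exact h).2
    have h2 : [] ∈ residual v'.1 L := by simpa [residual] using hv'
    rw [← h1] at h2
    simpa [residual] using h2
  · intro h
    exact ⟨v, h, rfl⟩

theorem canonicalAcceptor_language [Finite α] (hL : Recognizable L)
    (hK : (synProfile L).const = K) (hC : (synProfile L).C K) :
    (canonicalAcceptor L).language = L := by
  ext w
  constructor
  · rintro ⟨q, ν, hq, h⟩
    obtain ⟨v, hv, rfl, -⟩ := canonicalAcceptor_eq_of_reaches hL hK hC h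
    exact hv.mem_iff.2 (mem_canonicalAcceptor_accept.1 hq)
  · intro hw
    obtain ⟨v, hv, h⟩ := canonicalAcceptor_reaches hL hK w
    exact ⟨_, _, mem_canonicalAcceptor_accept.2 (hv.mem_iff.1 hw), h⟩

theorem canonicalAcceptor_hasMaxConst (hK : (synProfile L).const = K)
    (hmin : ∀ K', (synProfile L).C K' → K ≤ K') : (canonicalAcceptor L).HasMaxConst K := by
  refine hasMaxConst_of_phi _ _ (fun θ hθ => ?_) (fun h => ?_) fun a => ?_
  · obtain ⟨v, n, a, rfl⟩ := (mem_canonicalAcceptor_trans hK).1 hθ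
    exact ⟨_, rfl⟩
  -- Without letters `C` holds vacuously at 0.
  · exact Nat.le_zero.1 (hmin 0 fun _ a => h.elim a)
  · refine ⟨_, (mem_canonicalAcceptor_trans hK).2 ⟨HI.nil, 2 * K + 1, a, rfl⟩, phi_of_lt ?_⟩
    refine lt_of_lt_of_le ?_ le_add_self
    rw [lt_div_iff₀ (by norm_num)]
    norm_cast
    omega

/-- The canonical acceptor, completed and renamed to states in `Type`, attains K; conversely
`RegionAut.profile_C` makes the maximum constant of any 1-DTA for `L` satisfy `C`, so it is at least
K. -/
theorem languageConst_eq [Finite α] (hL : Recognizable L)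
    (hK : (synProfile L).const = K) (hC : (synProfile L).C K)
    (hmin : ∀ K', (synProfile L).C K' → K ≤ K') : languageConst L = K := by
  have hmax := canonicalAcceptor_hasMaxConst hK hmin
  have hdta := canonicalAcceptor_isDTA hL hK hC
  have hfin := finite_canonicalState hL
  have hmem : ∃ (Q : Type) (A : OneTA α Q), A.IsDTA ∧ A.HasMaxConst K ∧ A.language = L := by
    obtain ⟨Q, B, h1, h2, h3⟩ := ((canonicalAcceptor L).toRegionAut hmax.maxConst_le).exists_dta
      (some (canonicalAcceptor L).init)
    refine ⟨Q, B, h1, h2 fun h => Nat.le_zero.1 (hmin 0 fun _ a => h.elim a), ?_⟩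
    rw [h3, OneTA.toRegionAut_lang hdta.deterministic,
      canonicalAcceptor_language hL hK hC]
  refine le_antisymm (Nat.sInf_le hmem) ?_
  obtain ⟨Q, B, h1, h2, h3⟩ := Nat.sInf_mem (s := {K | ∃ (Q : Type) (A : OneTA α Q),
    A.IsDTA ∧ A.HasMaxConst K ∧ A.language = L}) ⟨K, hmem⟩
  have := h1.finite_states
  exact hmin _ ((B.toRegionAut h2.maxConst_le).profile_C
    ((OneTA.toRegionAut_lang h1.deterministic _).trans h3))

/-- The region of a state of the canonical acceptor. -/
def canonicalRegion (L : TimedLanguage α) (K : ℕ) (q : CanonicalState L) : Set ℝ≥0 :=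
  {z | RegionEqUpTo K (Quotient.lift (fun v : HI α => synResetVal L v.1) 
    (fun v v' (h : (synRel L).r v v') => h.1) q) z}

theorem canonicalAcceptor_isRegionAssignment [Finite α] (hL : Recognizable L)
    (hK : (synProfile L).const = K) (hC : (synProfile L).C K) :
    (canonicalAcceptor L).IsRegionAssignment K (canonicalRegion L K) := by
  refine ⟨fun q => ⟨_, rfl⟩, fun w q ν h => ?_⟩
  obtain ⟨v, hv, rfl, rfl⟩ := canonicalAcceptor_eq_of_reaches hL hK hC h
  exact RegionEq.upTo hv.1.symm K

theorem synResetVal_concat_of_ne_zero {v : HI α} {n : ℕ} {a : α}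
    (h : synResetVal L (v.concat n a).1 ≠ 0) :
    synResetVal L (v.concat n a).1 = synResetVal L v.1 + (n : ℝ≥0) / 2 :=
  synResetVal_of_not_recognizable fun hrec => h (synResetVal_of_recognizable hrec)

/-- The reset flag depends only on R^L of the target. On a transition without reset this value is
the very clock value that defines the guard. -/
theorem canonicalAcceptor_isSyntacticRegionAssignment (hK : (synProfile L).const = K) :
    (canonicalAcceptor L).IsSyntacticRegionAssignment (canonicalRegion L K) := by
  intro q
  constructor
  · rintro ⟨θ, hθ, rfl, hr⟩
    obtain ⟨v, n, a, rfl⟩ := (mem_canonicalAcceptor_trans hK).1 hθ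
    have h0 : synResetVal L (v.concat n a).1 = 0 := of_decide_eq_true hr
    constructor
    · intro θ' hθ' htgt
      obtain ⟨v', n', a', rfl⟩ := (mem_canonicalAcceptor_trans hK).1 hθ'
      have h1 : synResetVal L (v'.concat n' a').1 = synResetVal L (v.concat n a).1 :=
        (Quotient.exact htgt).1
      exact decide_eq_true (h1.trans h0)
    · change {z | RegionEqUpTo K (synResetVal L (v.concat n a).1) z} = {0}
      rw [h0, region_zero]
  · intro hno θ hθ htgt
    subst htgt
    have hr : θ.reset ≠ true := fun h => hno ⟨θ, hθ, rfl, h⟩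
    obtain ⟨v, n, a, rfl⟩ := (mem_canonicalAcceptor_trans hK).1 hθ
    have h0 : synResetVal L (v.concat n a).1 ≠ 0 := fun h => hr (decide_eq_true h)
    change _ = {z | RegionEqUpTo K (synResetVal L (v.concat n a).1) z}
    rw [sat_phi, synResetVal_concat_of_ne_zero h0]

theorem canonicalAcceptor_isStrictAcceptor [Finite α] (hL : Recognizable L)
    (hK : (synProfile L).const = K) (hC : (synProfile L).C K)
    (hmin : ∀ K', (synProfile L).C K' → K ≤ K') :
    (canonicalAcceptor L).IsStrictAcceptor K where
  isAcceptor :=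
    { isDTA := canonicalAcceptor_isDTA hL hK hC
      complete := canonicalAcceptor_complete hL hK hC
      maxConst := canonicalAcceptor_hasMaxConst hK hmin
      guard_region := by
        intro θ hθ
        obtain ⟨v, n, a, rfl⟩ := (mem_canonicalAcceptor_trans hK).1 hθ
        exact ⟨_, sat_phi _ _⟩
      region := ⟨_, canonicalAcceptor_isRegionAssignment hL hK hC⟩ }
  strict := by
    intro θ hθ m hm
    obtain ⟨v, n, a, rfl⟩ := (mem_canonicalAcceptor_trans hK).1 hθ
    -- An equality guard makes this clock value an integer; without a reset it would be a nonzero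
    -- integral value of R^L.
    have h1 := mem_phi_self K (synResetVal L v.1 + (n : ℝ≥0) / 2)
    dsimp only at hm
    rw [hm] at h1
    by_contra hr
    have h0 : synResetVal L (v.concat n a).1 ≠ 0 := fun h => hr (decide_eq_true h)
    exact h0 (synResetVal_eq_zero_of_natCast hL ((synResetVal_concat_of_ne_zero h0).trans h1))

/-! ### Minimality -/

variable {Q : Type v} {B : OneTA α Q}

theorem OneTA.IsAcceptor.exists_reaches (hB : B.IsAcceptor K) (w : TimedWord α) :
    ∃ c, B.Reaches (B.init, 0) w c := by
  obtain ⟨e, ⟨c, h⟩, -⟩ := hB.complete w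
  exact ⟨c, e, h⟩

theorem OneTA.IsAcceptor.residual_eq (hB : B.IsAcceptor K) (hBL : B.language = L)
    {w : TimedWord α} {c : Q × ℝ≥0} (h : B.Reaches (B.init, 0) w c) :
    residual w L = (B.toRegionAut hB.maxConst.maxConst_le).lang (some c.1, c.2) := by
  rw [← OneTA.toRegionAut_conf hB.isDTA.deterministic hB.maxConst.maxConst_le h, ← hBL,
    ← OneTA.toRegionAut_lang hB.isDTA.deterministic hB.maxConst.maxConst_le,
    RegionAut.residual_lang]

/-- The last step of a run. -/
theorem OneTA.Deterministic.reaches_concat (hB : B.Deterministic) {c c' c'' : Q × ℝ≥0}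
    {w : TimedWord α} {t : ℝ≥0} {a : α} (h : B.Reaches c w c')
    (h' : B.Reaches c (w ++ [(t, a)]) c'') :
    ∃ θ ∈ B.trans, c'.2 + t ∈ θ.guard.sat ∧ c'' = (θ.tgt, if θ.reset then 0 else c'.2 + t) := by
  obtain ⟨e, h⟩ := h
  obtain ⟨e', h'⟩ := h'
  induction h generalizing e' with
  | nil c =>
    generalize hx : ([] ++ [(t, a)] : TimedWord α) = x at h'
    cases h' with
    | nil => simp at hx
    | cons θ ν t w e c' hθ hg hrun =>
      obtain ⟨h1, rfl⟩ := List.cons.inj hx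
      obtain ⟨rfl, -⟩ := Prod.mk.inj h1
      exact ⟨θ, hθ, hg, hrun.eq_of_nil⟩
  | cons θ ν s w e c' hθ hg hrun ih =>
    rw [List.cons_append] at h'
    generalize hs : θ.src = s at h'
    generalize ha : θ.letter = b at h'
    cases h' with
    | cons θ' _ _ _ e' _ hθ' hg' hrun' =>
      obtain rfl : θ = θ' := hB.fires_unique ⟨hθ, hs, ha, hg⟩ ⟨hθ', rfl, rfl, hg'⟩
      exact ih _ hrun'

/-- The K-region of an integer m ≤ K is {m}, so a transition taken at clock value m has that guard
and resets. -/
theorem OneTA.IsStrictAcceptor.clock_natCast (hB : B.IsStrictAcceptor K) {w : TimedWord α}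
    {c : Q × ℝ≥0} (h : B.Reaches (B.init, 0) w c) {m : ℕ} (hm : c.2 = m) :
    c.2 = 0 ∨ (K : ℝ≥0) < c.2 := by
  cases w using List.reverseRecOn with
  | nil =>
    obtain ⟨e, h⟩ := h
    exact Or.inl (by rw [h.eq_of_nil])
  | append_singleton w p =>
    obtain ⟨c', h'⟩ := hB.isAcceptor.exists_reaches w
    obtain ⟨θ, hθ, hg, rfl⟩ := hB.isAcceptor.isDTA.deterministic.reaches_concat h' h
    dsimp only at hm ⊢
    split_ifs at hm ⊢ with hr
    · exact Or.inl rfl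
    · by_contra! hcon
      have hmK : m ≤ K := by
        have := hcon.2
        rw [hm] at this
        exact_mod_cast this
      refine hr (hB.strict θ hθ m ?_)
      rw [hm] at hg
      rw [(hB.isAcceptor.guard_region θ hθ).eq_of_mem hg]
      ext z
      refine ⟨fun hz => region_natCast hmK hz, ?_⟩
      rintro rfl
      exact .refl K _

theorem OneTA.IsAcceptor.recognizable_of_lt [Finite α] (hB : B.IsAcceptor K)
    (hBL : B.language = L) {w : TimedWord α} {c : Q × ℝ≥0} (h : B.Reaches (B.init, 0) w c)
    (hc : (K : ℝ≥0) < c.2) : Recognizable (residual w L) := by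
  have := hB.isDTA.finite_states
  rw [hB.residual_eq hBL h]
  exact RegionAut.recognizable_of_lt _ _ hc

theorem OneTA.IsAcceptor.recognizable_of_natCast [Finite α] (hB : B.IsAcceptor K)
    (hBL : B.language = L) {w : TimedWord α} {c : Q × ℝ≥0} (h : B.Reaches (B.init, 0) w c)
    {m : ℕ} (hc : c.2 = m) : Recognizable (residual w L) := by
  have := hB.isDTA.finite_states
  rw [hB.residual_eq hBL h, hc]
  exact RegionAut.recognizable_natCast _ _ _

theorem exists_natCast_add_of_not_natCast {x y : ℝ≥0} (hx : HalfIntegral x)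
    (hy : HalfIntegral y) (hx' : ¬ ∃ n : ℕ, x = n) (hy' : ¬ ∃ n : ℕ, y = n) :
    ∃ n : ℕ, x + y = n := by
  obtain ⟨n, rfl⟩ := (halfIntegral_even_or_odd hx).resolve_left hx'
  obtain ⟨m, rfl⟩ := (halfIntegral_even_or_odd hy).resolve_left hy'
  refine ⟨n + m + 1, ?_⟩
  push_cast
  rw [add_add_add_comm, add_halves]

/-- In a strict acceptor, a half-integral word with nonzero syntactic reset value leads to a
configuration with that clock value. -/
theorem OneTA.IsStrictAcceptor.clock_eq [Finite α] (hL : Recognizable L)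
    (hB : B.IsStrictAcceptor K) (hBL : B.language = L) (v : HI α) {c : Q × ℝ≥0}
    (h : B.Reaches (B.init, 0) v.1 c) (hv : synResetVal L v.1 ≠ 0) :
    c.2 = synResetVal L v.1 := by
  have hBA := hB.isAcceptor
  have hdet := hBA.isDTA.deterministic
  have half : ∀ (v : HI α) {c : Q × ℝ≥0}, B.Reaches (B.init, 0) v.1 c → HalfIntegral c.2 := by
    intro v c h
    have h1 := RegionAut.conf_halfIntegral (B.toRegionAut hBA.maxConst.maxConst_le)
      (some B.init) v
    rwa [OneTA.toRegionAut_conf hdet hBA.maxConst.maxConst_le h] at h1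
  obtain ⟨w, hw⟩ := v
  dsimp only at *
  induction w using List.reverseRecOn generalizing c with
  | nil => exact absurd (synResetVal_nil L) hv
  | append_singleton w p ih =>
    obtain ⟨t, a⟩ := p
    have hw' : ∀ q ∈ w, ∃ m : ℕ, q.1 = (m : ℝ≥0) / 2 := fun q hq => hw q (by simp [hq])
    have ht : HalfIntegral t := hw (t, a) (by simp)
    have hrec : ¬ Recognizable (residual (w ++ [(t, a)]) L) :=
      fun h => hv (synResetVal_of_recognizable h)
    have hR := synResetVal_of_not_recognizable hrec
    obtain ⟨c', h'⟩ := hBA.exists_reaches w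
    -- A reset here would make the residual recognizable.
    have hc : c.2 = c'.2 + t := by
      obtain ⟨θ, -, -, rfl⟩ := hdet.reaches_concat h' h
      by_cases hr : θ.reset = true
      · exact absurd (hBA.recognizable_of_natCast hBL h (m := 0) (by simp [hr])) hrec
      · simp only [hr]; rfl
    rw [hc, hR]
    by_cases h0 : synResetVal L w = 0
    · congr 1
      rw [h0] at hR ⊢
      have ht' : ¬ ∃ n : ℕ, t = n := by
        rintro ⟨n, hn⟩
        exact hv (synResetVal_eq_zero_of_natCast hL (hR.trans (by rw [zero_add, hn])))
      -- The previous clock value must be 0: another integer would exceed K by strictness, and a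
      -- non-integral half-integer plus the non-integral t would be an integer. Either way the
      -- residual would be recognizable.
      by_cases hc' : ∃ n : ℕ, c'.2 = n
      · obtain ⟨n, hn⟩ := hc'
        refine (hB.clock_natCast h' hn).resolve_right fun hlt => hrec ?_
        exact hBA.recognizable_of_lt hBL h (hc ▸ hlt.trans_le le_self_add)
      · obtain ⟨n, hn⟩ := exists_natCast_add_of_not_natCast (half ⟨w, hw'⟩ h') ht hc' ht'
        exact absurd (hBA.recognizable_of_natCast hBL h (hc.trans hn)) hrec
    · rw [ih hw' h' h0]

/-- Half-integral words leading to the same state of a strict acceptor are equivalent. -/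
theorem OneTA.IsStrictAcceptor.synRel_of_reaches [Finite α] (hL : Recognizable L)
    (hB : B.IsStrictAcceptor K) (hBL : B.language = L) {v v' : HI α} {c c' : Q × ℝ≥0}
    (h : B.Reaches (B.init, 0) v.1 c) (h' : B.Reaches (B.init, 0) v'.1 c') (hq : c.1 = c'.1) :
    (synRel L).r v v' := by
  have hBA := hB.isAcceptor
  have hdet := hBA.isDTA.deterministic
  obtain ⟨region, hreg, hmem⟩ := hBA.region
  have half : ∀ (v : HI α) {c : Q × ℝ≥0}, B.Reaches (B.init, 0) v.1 c → HalfIntegral c.2 := by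
    intro v c h
    have h1 := RegionAut.conf_halfIntegral (B.toRegionAut hBA.maxConst.maxConst_le)
      (some B.init) v
    rwa [OneTA.toRegionAut_conf hdet hBA.maxConst.maxConst_le h] at h1
  -- Both clock values are half-integers in the region attached to the common state.
  have hcc : c.2 = c'.2 ∨ (K : ℝ≥0) < c.2 ∧ (K : ℝ≥0) < c'.2 := by
    have h1 := hmem v.1 c.1 c.2 h
    have h2 := hmem v'.1 c'.1 c'.2 h'
    rw [← hq] at h2
    exact ((hreg c.1).regionEqUpTo h1 h2).imp_left
      fun h3 => h3.eq_of_halfIntegral (half v h) (half v' h')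
  have hres : residual v.1 L = residual v'.1 L := by
    rw [hBA.residual_eq hBL h, hBA.residual_eq hBL h', ← hq]
    rcases hcc with h1 | h1
    · rw [h1]
    · exact RegionAut.lang_eq_of_lt _ _ h1.1 h1.2
  refine ⟨?_, hres⟩
  change synResetVal L v.1 = synResetVal L v'.1
  by_cases h0 : Recognizable (residual v.1 L)
  · rw [synResetVal_of_recognizable h0, synResetVal_of_recognizable (hres ▸ h0)]
  · have h0' : ¬ Recognizable (residual v'.1 L) := hres ▸ h0
    rw [← synResetVal_eq_zero_iff hL] at h0 h0'
    rw [← hB.clock_eq hL hBL v h h0, ← hB.clock_eq hL hBL v' h' h0']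
    refine hcc.resolve_right fun h1 => h0 ?_
    exact synResetVal_of_recognizable (hBA.recognizable_of_lt hBL h h1.1)

theorem OneTA.IsStrictAcceptor.card_le [Finite α] (hL : Recognizable L)
    (hB : B.IsStrictAcceptor K) (hBL : B.language = L) :
    Nat.card (CanonicalState L) ≤ Nat.card Q := by
  have := hB.isAcceptor.isDTA.finite_states
  choose c hc using fun s : CanonicalState L => hB.isAcceptor.exists_reaches s.out.1
  refine Nat.card_le_card_of_injective (fun s => (c s).1) fun s s' h => ?_
  rw [← s.out_eq, ← s'.out_eq]
  exact Quotient.sound (hB.synRel_of_reaches hL hBL (hc s) (hc s') h)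

end

end OneClock

theorem mainTheorem5 {α : Type*} [Finite α] (L : OneClock.TimedLanguage α)
    (hL : OneClock.Recognizable L) :
    ((OneClock.canonicalAcceptor L).IsStrictAcceptor (OneClock.languageConst L) ∧
      (∃ region : OneClock.CanonicalState L → Set NNReal,
        (OneClock.canonicalAcceptor L).IsRegionAssignment (OneClock.languageConst L) region ∧
        (OneClock.canonicalAcceptor L).IsSyntacticRegionAssignment region) ∧
      (OneClock.canonicalAcceptor L).language = L ∧
      (OneClock.canonicalAcceptor L).HasResetFunction (OneClock.synReset L).toFun) ∧
    ∀ (Q : Type*) (B : OneClock.OneTA α Q) (K : ℕ),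
      B.IsStrictAcceptor K → B.language = L →
        Nat.card (OneClock.CanonicalState L) ≤ Nat.card Q := by
  obtain ⟨K, hK, hC, hmin⟩ := OneClock.exists_const_eq hL
  rw [OneClock.languageConst_eq hL hK hC hmin]
  refine ⟨⟨OneClock.canonicalAcceptor_isStrictAcceptor hL hK hC hmin,
    ⟨_, OneClock.canonicalAcceptor_isRegionAssignment hL hK hC,
      OneClock.canonicalAcceptor_isSyntacticRegionAssignment hK⟩,
    OneClock.canonicalAcceptor_language hL hK hC, fun w => ?_⟩,
    fun Q B K' hB hBL => hB.card_le hL hBL⟩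
  obtain ⟨v, -, h⟩ := OneClock.canonicalAcceptor_reaches hL hK w
  exact ⟨_, h⟩
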